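/- Let $p$ be a prime and let $G=\bigoplus_{i\in I}G_i$, where $I$ is a totally ordered index set and each $G_i$ is a homocyclic abelian group of exponent $p^{n_i}$ and finite rank $r_i$ (that is, $G_i\cong(\mathbb Z/p^{n_i})^{r_i}$ with $n_i\ge 1$ and $r_i\ge 1$), with $n_i<n_j$ whenever $i<j$. (Hence $I$ is finite or has the order type of $\mathbb N$; if $I$ is non-empty, denote its least element by $1$, and if $i$ is not the greatest element, denote its successor by $i+1$.) Let $$\sigma:\operatorname{Aut}(G)\to\prod_{i}\operatorname{Aut}(G_i/pG_i)\cong\prod_i GL_{r_i}(\mathbb Z_p),\qquad \mathbb Z_p=\mathbb Z/p\mathbb Z,$$ be the natural homomorphism, which sends an automorphism $A$ to the family of the maps that its diagonal components $A_{ii}:G_i\to G\xrightarrow{A}G\to G_i$ induce on $G_i/pG_i$, and let $\Delta(G)=\ker\sigma$. Say that $\operatorname{Aut}(G)$ is a semidirect product of $\Delta(G)$ by $\prod_iGL_{r_i}(\mathbb Z_p)$ if the normal subgroup $\Delta(G)$ has a complement in $\operatorname{Aut}(G)$ that is isomorphic to $\prod_iGL_{r_i}(\mathbb Z_p)$. (1)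 If $p\ge5$, then $\operatorname{Aut}(G)$ is a semidirect product of $\Delta(G)$ by $\prod_iGL_{r_i}(\mathbb Z_p)$ if and only if $G_i$ has rank $1$ for every $i>1$, and $G_1$ is elementary abelian or has rank $1$. (2) If $p=3$ and $n_{i+1}-n_i>1$ for all $i$, then $\operatorname{Aut}(G)$ is a semidirect product of $\Delta(G)$ by $\prod_iGL_{r_i}(\mathbb Z_p)$ if and only if $G_i$ has rank $\le2$ for every $i>1$, and $G_1$ is elementary abelian or has rank $\le2$. (3) If $p=2$ and $n_{i+1}-n_i>1$ for all $i$, then $\operatorname{Aut}(G)$ is a semidirect product of $\Delta(G)$ by $\prod_iGL_{r_i}(\mathbb Z_p)$ if and only if $G_i$ has rank $\le3$ for every $i>1$, and $G_1$ is elementary abelian or has rank $\le3$. -/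

import Mathlib

open scoped DirectSum

noncomputable section

/-- `A` is an internal semidirect product of its subgroup `N` by the group `Q`: `N` is normal and
has a complement that is isomorphic to `Q`. -/
def IsSemidirectProductBy {A : Type*} [Group A] (N : Subgroup A) (Q : Type*) [Group Q] : Prop :=
  N.Normal ∧ ∃ K : Subgroup A, N.IsComplement' K ∧ Nonempty (K ≃* Q)

/-- `A` is homocyclic of type `(p ^ n, …, p ^ n)` with `r` terms. For `n, r ≥ 1` this says that `A`
is homocyclic of exponent `p ^ n` and rank `r`. -/
def IsHomocyclic (p n r : ℕ) (A : Type*) [AddCommGroup A] : Prop :=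
  Nonempty (A ≃+ (Fin r → ZMod (p ^ n)))

/-- `A` is an elementary abelian `p`-group. -/
def IsElementaryAbelian (p : ℕ) (A : Type*) [AddCommGroup A] : Prop :=
  ∀ x : A, p • x = 0

/-- The subgroup `pA`. -/
def pMultiples (p : ℕ) (A : Type*) [AddCommGroup A] : AddSubgroup A :=
  (nsmulAddMonoidHom (α := A) p).range

theorem mem_pMultiples {p : ℕ} {A : Type*} [AddCommGroup A] {x : A} :
    x ∈ pMultiples p A ↔ ∃ y, p • y = x := Iff.rfl

theorem IsHomocyclic.pow_nsmul {p n r : ℕ} {A : Type*} [AddCommGroup A]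
    (h : IsHomocyclic p n r A) (x : A) : p ^ n • x = 0 := by
  obtain ⟨e⟩ := h
  apply e.injective
  rw [map_nsmul, map_zero]
  ext k
  simp only [Pi.smul_apply, Pi.zero_apply, nsmul_eq_mul, CharP.cast_eq_zero, zero_mul]

theorem IsHomocyclic.mem_pMultiples {p n r m : ℕ} [hp : Fact p.Prime] {A : Type*} [AddCommGroup A]
    (h : IsHomocyclic p n r A) (hm : m < n) {x : A} (hx : p ^ m • x = 0) :
    x ∈ pMultiples p A := by
  obtain ⟨e⟩ := h
  have key : ∀ k, ∃ z : ZMod (p ^ n), p • z = e x k := by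
    intro k
    have h1 : p ^ m • e x k = 0 := by
      have := congrFun (congrArg e hx) k
      simpa only [map_nsmul, map_zero, Pi.smul_apply, Pi.zero_apply] using this
    have : NeZero (p ^ n) := ⟨pow_ne_zero _ hp.out.ne_zero⟩
    rw [← ZMod.natCast_zmod_val (e x k), nsmul_eq_mul, ← Nat.cast_mul,
      ZMod.natCast_eq_zero_iff] at h1
    have h2 : p ^ m * p ∣ p ^ m * (e x k).val := by
      rw [← pow_succ]
      exact (pow_dvd_pow p hm).trans h1
    obtain ⟨c, hc⟩ := Nat.dvd_of_mul_dvd_mul_left (pow_pos hp.out.pos m) h2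
    refine ⟨(c : ZMod (p ^ n)), ?_⟩
    rw [← ZMod.natCast_zmod_val (e x k), hc, nsmul_eq_mul, Nat.cast_mul]
  choose z hz using key
  refine ⟨e.symm z, ?_⟩
  apply e.injective
  change e (p • e.symm z) = e x
  rw [map_nsmul, e.apply_symm_apply]
  ext k
  exact hz k

section Sigma

variable {ι : Type*} [LinearOrder ι] {p : ℕ} {n r : ι → ℕ}
  {G : ι → Type*} [∀ i, AddCommGroup (G i)]

/-- The diagonal block `A_ii : G_i → G_i` of an endomorphism `A` of `⨁ i, G_i`. -/
def diagBlock (A : (⨁ i, G i) →+ (⨁ i, G i)) (i : ι) : G i →+ G i :=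
  (DFinsupp.evalAddMonoidHom i).comp (A.comp (DirectSum.of G i))

theorem diagBlock_apply (A : (⨁ i, G i) →+ (⨁ i, G i)) (i : ι) (x : G i) :
    diagBlock A i x = A (DirectSum.of G i x) i := rfl

/-- Reduction of `A_ii` modulo `p`, an endomorphism of `G_i / p G_i`. -/
def diagBlockMod (p : ℕ) (A : (⨁ i, G i) →+ (⨁ i, G i)) (i : ι) :
    G i ⧸ pMultiples p (G i) →+ G i ⧸ pMultiples p (G i) :=
  QuotientAddGroup.map _ _ (diagBlock A i) (by
    rintro _ ⟨y, rfl⟩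
    exact ⟨diagBlock A i y, (map_nsmul (diagBlock A i) p y).symm⟩)

theorem diagBlockMod_mk (A : (⨁ i, G i) →+ (⨁ i, G i)) (i : ι) (x : G i) :
    diagBlockMod p A i (QuotientAddGroup.mk x) = QuotientAddGroup.mk (diagBlock A i x) := rfl

/-- The off-diagonal blocks do not contribute to the diagonal modulo `p`. -/
theorem apply_mem_pMultiples [Fact p.Prime] (hn : StrictMono n)
    (hG : ∀ i, IsHomocyclic p (n i) (r i) (G i)) (A : (⨁ i, G i) →+ (⨁ i, G i)) (i : ι)
    (z : ⨁ i, G i) (hz : p ^ n i • z = 0) (hzi : z i = 0) :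
    A z i ∈ pMultiples p (G i) := by
  classical
  rw [← DirectSum.sum_support_of z, map_sum, DFinsupp.finsetSum_apply]
  refine AddSubgroup.sum_mem _ fun j _ => ?_
  rcases lt_trichotomy j i with h | h | h
  · refine (hG i).mem_pMultiples (hn h) ?_
    rw [← DFinsupp.smul_apply, ← map_nsmul, ← map_nsmul, (hG j).pow_nsmul, map_zero, map_zero]
    rfl
  · subst h
    rw [hzi, map_zero, map_zero]
    exact zero_mem _
  · have h1 : p ^ n i • z j = 0 := by
      rw [← DFinsupp.smul_apply]
      exact DFunLike.congr_fun hz j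
    obtain ⟨w, hw⟩ := (hG j).mem_pMultiples (hn h) h1
    refine ⟨A (DirectSum.of G j w) i, ?_⟩
    rw [← hw]
    change p • _ = A (DirectSum.of G j (p • w)) i
    rw [map_nsmul, map_nsmul]
    rfl

theorem diagBlockMod_comp [Fact p.Prime] (hn : StrictMono n)
    (hG : ∀ i, IsHomocyclic p (n i) (r i) (G i)) (A B : (⨁ i, G i) →+ (⨁ i, G i)) (i : ι) :
    diagBlockMod p (A.comp B) i = (diagBlockMod p A i).comp (diagBlockMod p B i) := by
  ext x
  change (QuotientAddGroup.mk (diagBlock (A.comp B) i x) : G i ⧸ pMultiples p (G i)) =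
    QuotientAddGroup.mk (diagBlock A i (diagBlock B i x))
  rw [eq_comm, QuotientAddGroup.eq]
  have key := apply_mem_pMultiples hn hG A i
    (B (DirectSum.of G i x) - DirectSum.of G i (B (DirectSum.of G i x) i)) (by
      rw [nsmul_sub, ← map_nsmul, ← map_nsmul, ← map_nsmul, (hG i).pow_nsmul,
        (hG i).pow_nsmul, map_zero, map_zero, sub_zero]) (by
      rw [DirectSum.sub_apply, DirectSum.of_eq_same, sub_self])
  rw [map_sub, DirectSum.sub_apply] at key
  rw [neg_add_eq_sub]
  exact key

theorem diagBlockMod_id (i : ι) :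
    diagBlockMod p (AddMonoidHom.id (⨁ i, G i)) i = AddMonoidHom.id _ := by
  ext x
  change (QuotientAddGroup.mk (DirectSum.of G i x i) : G i ⧸ pMultiples p (G i)) =
    QuotientAddGroup.mk x
  rw [DirectSum.of_eq_same]

/-- The natural homomorphism `σ : Aut(⨁ G_i) → ∏ Aut(G_i / p G_i)`, which sends `A` to the family
of its diagonal blocks modulo `p`. The automorphism group of an abelian group is the group of units
of its endomorphism ring. -/
def sigma [Fact p.Prime] (hn : StrictMono n) (hG : ∀ i, IsHomocyclic p (n i) (r i) (G i)) :
    (AddMonoid.End (⨁ i, G i))ˣ →* ((i : ι) → (AddMonoid.End (G i ⧸ pMultiples p (G i)))ˣ) :=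
  MulEquiv.piUnits.toMonoidHom.comp <| Units.map
    { toFun := fun (A : AddMonoid.End (⨁ i, G i)) i => diagBlockMod p A i
      map_one' := funext fun i => diagBlockMod_id i
      map_mul' := fun A B => funext fun i => diagBlockMod_comp hn hG A B i }

/-- `Δ(G) = ker σ`. -/
def Delta [Fact p.Prime] (hn : StrictMono n) (hG : ∀ i, IsHomocyclic p (n i) (r i) (G i)) :
    Subgroup (AddMonoid.End (⨁ i, G i))ˣ :=
  (sigma hn hG).ker

end Sigma

end

/-! If every reduction GL_r(ℤ/p^n) → GL_r(ℤ/p), with n = n_i and r = r_i, is a split surjection,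
then block diagonal automorphisms form a complement (`isSemidirectProductBy_of_reductionSplits`). It
splits for n = 1 trivially, for r = 1 by Teichmüller lifts, and in three exceptional cases by
lifting to characteristic zero: GL_2(2) to ℤ, GL_3(2) ≅ PSL_2(7) to ℤ[(1 + √-7)/2], and GL_2(3) to
ℤ[√-2]. The quadratic equations involved have p-adic roots, so these rings map to every ℤ/p^n.

Conversely, a complement gives an endomorphism s of Aut(G) that kills Δ(G) and satisfies s(g) ≡ g
modulo Δ(G). Let n_i ≥ 2 and r_i ≥ 2, and let T be a transvection of G_i. Then T^p lies in Δ(G), so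
s(T) = 1 + N satisfies (1 + N)^p = 1. The layers G[p] ∩ p^k G filter the socle, and the step from k
= n_i - 1 to n_i sees exactly the socle of G_i. For p ≥ 5 the binomial expansion shows that N
vanishes on this step (`apply_mem_socleLayer_of_pow_eq_one`), but T - 1 does not, and N differs from
T - 1 by something that does (`IsSemidirectProductBy.rank_le_one`).

For p = 2, 3 the gaps n_{i+1} - n_i > 1 make the diagonal block modulo p² multiplicative
(`blockModSq`). Hence s yields a multiplicative lift to ℤ/p² of integer matrices modulo p
(`CongruenceLift`). Comparing a few matrix entries excludes 3 × 3 matrices for p = 3 and 4 × 4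
matrices for p = 2. -/

open scoped DirectSum

/-! ### Complements, sections and rank one Bruhat decompositions. -/

section Groups

/-- A complement of a normal subgroup gives a retraction onto it, with values congruent to the
arguments modulo the normal subgroup. -/
theorem IsSemidirectProductBy.exists_retraction {A : Type*} [Group A] {N : Subgroup A} {Q : Type*}
    [Group Q] (h : IsSemidirectProductBy N Q) :
    ∃ s : A →* A, (∀ g, g⁻¹ * s g ∈ N) ∧ ∀ g ∈ N, s g = 1 := by
  obtain ⟨hN, K, hK, -⟩ := h
  refine ⟨K.subtype.comp (hK.symm.QuotientMulEquiv.toMonoidHom.comp (QuotientGroup.mk' N)),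
    fun g => ?_, fun g hg => ?_⟩
  · rw [← QuotientGroup.eq]
    exact (hK.symm.QuotientMulEquiv.symm_apply_apply (QuotientGroup.mk' N g)).symm
  · have : QuotientGroup.mk' N g = 1 := (QuotientGroup.eq_one_iff g).2 hg
    simp only [MonoidHom.comp_apply, this, map_one]

theorem isSemidirectProductBy_ker {A B Q : Type*} [Group A] [Group B] [Group Q] (σ : A →* B)
    (τ : B →* A) (h : ∀ b, σ (τ b) = b) (e : Q ≃* B) : IsSemidirectProductBy σ.ker Q := by
  have hτ : Function.Injective τ := Function.LeftInverse.injective h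
  refine ⟨inferInstance, τ.range, Subgroup.isComplement'_of_disjoint_and_mul_eq_univ ?_ ?_,
    ⟨(e.trans (MonoidHom.ofInjective hτ)).symm⟩⟩
  · rw [Subgroup.disjoint_def]
    rintro _ hx ⟨b, rfl⟩
    rw [MonoidHom.mem_ker, h] at hx
    rw [hx, map_one]
  · refine Set.eq_univ_of_forall fun a => Set.mem_mul.2
      ⟨a * (τ (σ a))⁻¹, ?_, τ (σ a), ⟨_, rfl⟩, inv_mul_cancel_right _ _⟩
    rw [SetLike.mem_coe, MonoidHom.mem_ker, map_mul, map_inv, h, mul_inv_cancel]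

/-- Bruhat decomposition in relative rank one, for a Weyl element that is an involution. -/
theorem Subgroup.bruhat_rank_one {G : Type*} [Group G] (U T : Subgroup G) (w : G)
    (hT : T ≤ Subgroup.normalizer (U : Set G)) (hw : w * w = 1) (hwT : ∀ t ∈ T, w * t * w ∈ T)
    (hwU : ∀ u ∈ U, u ≠ 1 → ∃ u₁ ∈ U, ∃ t ∈ T, ∃ u₂ ∈ U, w * u * w = u₁ * t * w * u₂)
    {x : G} (hx : x ∈ Subgroup.closure ((U : Set G) ∪ T ∪ {w})) :
    (∃ u ∈ U, ∃ t ∈ T, x = u * t) ∨ ∃ u ∈ U, ∃ t ∈ T, ∃ u' ∈ U, x = u * t * w * u' := by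
  have hw' : w⁻¹ = w := inv_eq_of_mul_eq_one_left hw
  have hconj : ∀ {t u}, t ∈ T → u ∈ U → t * u * t⁻¹ ∈ U := fun ht hu =>
    (Subgroup.mem_normalizer_iff.1 (hT ht) _).1 hu
  have key : ∀ y g, g ∈ (U : Set G) ∪ T ∪ {w} →
      ((∃ u ∈ U, ∃ t ∈ T, y = u * t) ∨ ∃ u ∈ U, ∃ t ∈ T, ∃ u' ∈ U, y = u * t * w * u') →
      ((∃ u ∈ U, ∃ t ∈ T, y * g = u * t) ∨
        ∃ u ∈ U, ∃ t ∈ T, ∃ u' ∈ U, y * g = u * t * w * u') := by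
    rintro y g ((hg | hg) | hg) (⟨u, hu, t, ht, rfl⟩ | ⟨u, hu, t, ht, u', hu', rfl⟩)
    · exact .inl ⟨u * (t * g * t⁻¹), mul_mem hu (hconj ht hg), t, ht, by group⟩
    · exact .inr ⟨u, hu, t, ht, u' * g, mul_mem hu' hg, by group⟩
    · exact .inl ⟨u, hu, t * g, mul_mem ht hg, by group⟩
    · refine .inr ⟨u, hu, t * (w * g * w), mul_mem ht (hwT g hg), g⁻¹ * u' * g, ?_, ?_⟩
      · simpa using hconj (inv_mem hg) hu'
      · simp only [← mul_assoc]
        rw [mul_assoc _ w w, hw, mul_one, mul_inv_cancel_right]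
    · obtain rfl : g = w := hg
      exact .inr ⟨u, hu, t, ht, 1, one_mem _, by group⟩
    -- The only case that needs `hwU`: in u t w u' w, the factor w u' w is rewritten as an element
    -- of U T w U, or cancels when u' = 1.
    · obtain rfl : g = w := hg
      by_cases h1 : u' = 1
      · exact .inl ⟨u, hu, t, ht, by rw [h1, mul_one, mul_assoc, hw, mul_one]⟩
      · obtain ⟨u₁, h₁, s, hs, u₂, h₂, he⟩ := hwU u' hu' h1
        refine .inr ⟨u * (t * u₁ * t⁻¹), mul_mem hu (hconj ht h₁), t * s, mul_mem ht hs, u₂, h₂, ?_⟩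
        calc u * t * g * u' * g = u * t * (g * u' * g) := by group
          _ = u * (t * u₁ * t⁻¹) * (t * s) * g * u₂ := by rw [he]; group
  induction hx using Subgroup.closure_induction_right with
  | one => exact .inl ⟨1, one_mem _, 1, one_mem _, by simp⟩
  | mul_right y _ g hg hy => exact key y g hg hy
  | mul_inv_cancel y _ g hg hy =>
    refine key y _ ?_ hy
    rcases hg with (hg | hg) | hg
    · exact .inl (.inl (inv_mem hg))
    · exact .inl (.inr (inv_mem hg))
    · obtain rfl : g = w := hg
      exact .inr hw'

/-- A surjection of a group with a rank one Bruhat decomposition that is injective on the Borel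
subgroup `U T` and does not send the Weyl element into the image of `U T` is invertible. -/
theorem MonoidHom.exists_section_of_bruhat {G H : Type*} [Group G] [Group H] (φ : G →* H)
    (U T : Subgroup G) (w : G)
    (hT : T ≤ Subgroup.normalizer (U : Set G)) (hw : w * w = 1) (hwT : ∀ t ∈ T, w * t * w ∈ T)
    (hwU : ∀ u ∈ U, u ≠ 1 → ∃ u₁ ∈ U, ∃ t ∈ T, ∃ u₂ ∈ U, w * u * w = u₁ * t * w * u₂)
    (hφ : ∀ u ∈ U, ∀ t ∈ T, φ (u * t) = 1 → u * t = 1)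
    (hφw : ∀ u ∈ U, ∀ t ∈ T, φ (u * t) ≠ φ w)
    (hsurj : (Subgroup.closure ((U : Set G) ∪ T ∪ {w})).map φ = ⊤) :
    ∃ s : H →* G, ∀ h, φ (s h) = h := by
  set Γ := Subgroup.closure ((U : Set G) ∪ T ∪ {w})
  have hker : ∀ x ∈ Γ, φ x = 1 → x = 1 := by
    intro x hx h1
    rcases Subgroup.bruhat_rank_one U T w hT hw hwT hwU hx with
      ⟨u, hu, t, ht, rfl⟩ | ⟨u, hu, t, ht, u', hu', rfl⟩
    · exact hφ u hu t ht h1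
    -- If u t w u' were in the kernel, φ w would be φ (t⁻¹ u⁻¹ u'⁻¹), and t⁻¹ u⁻¹ u'⁻¹ lies in U T.
    · refine absurd ?_ (hφw (t⁻¹ * (u⁻¹ * u'⁻¹) * t) ?_ t⁻¹ (inv_mem ht))
      · simp only [map_mul, map_inv] at h1 ⊢
        rw [eq_comm, ← mul_right_inj (φ u * φ t), ← mul_left_inj (φ u'), h1]
        group
      · simpa using (Subgroup.mem_normalizer_iff.1 (hT (inv_mem ht)) _).1
          (mul_mem (inv_mem hu) (inv_mem hu'))
  have hbij : Function.Bijective (φ.comp Γ.subtype) := by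
    constructor
    · rw [injective_iff_map_eq_one]
      exact fun x hx => Subtype.ext (hker x x.2 hx)
    · intro h
      obtain ⟨x, hx, rfl⟩ := Subgroup.mem_map.1 (hsurj.symm ▸ Subgroup.mem_top h)
      exact ⟨⟨x, hx⟩, rfl⟩
  exact ⟨Γ.subtype.comp (MulEquiv.ofBijective _ hbij).symm.toMonoidHom,
    fun h => (MulEquiv.ofBijective _ hbij).apply_symm_apply h⟩

end Groups

/-! ### Sections of GL_r over rings of characteristic zero. -/

section Sections

/-- The subgroup whose elements are listed by `υ`. -/
def Subgroup.ofRange {G : Type*} [Group G] {k : ℕ} (υ : Fin k → G) (h1 : ∃ i, υ i = 1)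
    (hdiv : ∀ i j, ∃ l, υ i * (υ j)⁻¹ = υ l) : Subgroup G :=
  Subgroup.ofDiv (Set.range υ) (Set.nonempty_of_mem h1) (by
    rintro _ ⟨i, rfl⟩ _ ⟨j, rfl⟩
    obtain ⟨l, hl⟩ := hdiv i j
    exact ⟨l, hl.symm⟩)

/-- The form of `MonoidHom.exists_section_of_bruhat` in which all hypotheses are finite checks. -/
theorem MonoidHom.exists_section_of_bruhat_fin {G H : Type*} [Group G] [Group H] (φ : G →* H)
    {k l : ℕ} (υ : Fin k → G) (τ : Fin l → G) (w : G)
    (hU1 : ∃ i, υ i = 1) (hU : ∀ i j, ∃ m, υ i * (υ j)⁻¹ = υ m)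
    (hT1 : ∃ i, τ i = 1) (hT : ∀ i j, ∃ m, τ i * (τ j)⁻¹ = τ m)
    (hTU : ∀ i j, ∃ m, τ i * υ j * (τ i)⁻¹ = υ m) (hw : w * w = 1)
    (hwT : ∀ i, ∃ m, w * τ i * w = τ m)
    (hwU : ∀ i, υ i = 1 ∨ ∃ a b d, w * υ i * w = υ a * τ b * w * υ d)
    (hφ : ∀ i j, φ (υ i * τ j) = 1 → υ i * τ j = 1)
    (hφw : ∀ i j, φ (υ i * τ j) ≠ φ w)
    (hsurj : ∀ K : Subgroup H, (∀ a b, φ (υ a * τ b) ∈ K) →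
      (∀ a b d, φ (υ a * τ b * w * υ d) ∈ K) → K = ⊤) :
    ∃ s : H →* G, ∀ h, φ (s h) = h := by
  have hconj : ∀ i, ∀ u ∈ Subgroup.ofRange υ hU1 hU, τ i * u * (τ i)⁻¹ ∈
      Subgroup.ofRange υ hU1 hU := by
    rintro i _ ⟨j, rfl⟩
    obtain ⟨m, hm⟩ := hTU i j
    exact ⟨m, hm.symm⟩
  refine MonoidHom.exists_section_of_bruhat φ (Subgroup.ofRange υ hU1 hU)
    (Subgroup.ofRange τ hT1 hT) w ?_ hw ?_ ?_ ?_ ?_ (hsurj _ ?_ ?_)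
  · intro t ht
    rw [Subgroup.mem_normalizer_iff]
    refine fun u => ⟨fun hu => ?_, fun hu => ?_⟩
    · obtain ⟨i, rfl⟩ := ht
      exact hconj i u hu
    · obtain ⟨i, hi⟩ := inv_mem ht
      simpa [hi, mul_assoc] using hconj i _ hu
  · rintro _ ⟨i, rfl⟩
    obtain ⟨m, hm⟩ := hwT i
    exact ⟨m, hm.symm⟩
  · rintro _ ⟨i, rfl⟩ hi
    obtain ⟨a, b, d, h⟩ := (hwU i).resolve_left hi
    exact ⟨_, ⟨a, rfl⟩, _, ⟨b, rfl⟩, _, ⟨d, rfl⟩, h⟩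
  · rintro _ ⟨i, rfl⟩ _ ⟨j, rfl⟩
    exact hφ i j
  · rintro _ ⟨i, rfl⟩ _ ⟨j, rfl⟩
    exact hφw i j
  · exact fun a b => Subgroup.mem_map_of_mem _ (mul_mem
      (Subgroup.subset_closure (.inl (.inl ⟨a, rfl⟩)))
      (Subgroup.subset_closure (.inl (.inr ⟨b, rfl⟩))))
  · exact fun a b d => Subgroup.mem_map_of_mem _ (mul_mem (mul_mem (mul_mem
      (Subgroup.subset_closure (.inl (.inl ⟨a, rfl⟩)))
      (Subgroup.subset_closure (.inl (.inr ⟨b, rfl⟩))))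
      (Subgroup.subset_closure (.inr rfl))) (Subgroup.subset_closure (.inl (.inl ⟨d, rfl⟩))))

open Matrix in
-- Gaussian elimination. It reduces surjectivity onto GL_m(F) to exhibiting preimages of generators.
theorem Matrix.GeneralLinearGroup.eq_top_of_transvection_mem {m F : Type*} [Fintype m]
    [DecidableEq m] [Field F] (K : Subgroup (GL m F))
    (hdiag : ∀ D : m → F, (∀ i, D i ≠ 0) → ∃ g ∈ K, (g : Matrix m m F) = diagonal D)
    (htrans : ∀ i j, i ≠ j → ∀ c, ∃ g ∈ K, (g : Matrix m m F) = transvection i j c) : K = ⊤ := by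
  rw [eq_top_iff]
  intro g _
  obtain ⟨x, hx, hxg⟩ := diagonal_transvection_induction_of_det_ne_zero
    (fun M => ∃ g ∈ K, (g : Matrix m m F) = M) (g : Matrix m m F)
    (isUnit_iff_ne_zero.1 ((isUnit_iff_isUnit_det _).1 g.isUnit))
    (fun D hD => hdiag D fun i hi => hD (by
      rw [det_diagonal, Finset.prod_eq_zero (Finset.mem_univ i) hi]))
    (fun t => htrans t.i t.j t.hij t.c) (by
      rintro _ _ - - ⟨a, ha, rfl⟩ ⟨b, hb, rfl⟩
      exact ⟨a * b, mul_mem ha hb, rfl⟩)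
  rwa [← Units.ext hxg]

/-- Evaluation of `x + y ω` at a root of `X ^ 2 - b X - a`. -/
def QuadraticAlgebra.evalRoot {S : Type*} [CommRing S] {a b : ℤ} (u : S)
    (hu : u * u = a + b * u) : QuadraticAlgebra ℤ a b →+* S where
  toFun x := x.re + x.im * u
  map_one' := by simp
  map_zero' := by simp
  map_add' x y := by simp; ring
  map_mul' x y := by simp; linear_combination -(x.im * y.im : S) * hu

/-- Reduction `GL_r(ℤ/p^n) → GL_r(ℤ/p)` is a split surjection. -/
def ReductionSplits (p n r : ℕ) (h : p ∣ p ^ n) : Prop :=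
  ∃ s : GL (Fin r) (ZMod p) →* GL (Fin r) (ZMod (p ^ n)),
    ∀ g, Matrix.GeneralLinearGroup.map (ZMod.castHom h (ZMod p)) (s g) = g

/-- With R equal to ℤ or a quadratic order, a single section over R serves all exponents n. -/
theorem ReductionSplits.of_ring {p n r : ℕ} {h : p ∣ p ^ n} {R : Type*} [CommRing R]
    (ρ : R →+* ZMod p) (φ : R →+* ZMod (p ^ n)) (hφ : (ZMod.castHom h (ZMod p)).comp φ = ρ)
    (hs : ∃ s : GL (Fin r) (ZMod p) →* GL (Fin r) R,
      ∀ g, Matrix.GeneralLinearGroup.map ρ (s g) = g) : ReductionSplits p n r h := by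
  obtain ⟨s, hs⟩ := hs
  refine ⟨(Matrix.GeneralLinearGroup.map φ).comp s, fun g => ?_⟩
  rw [MonoidHom.comp_apply, ← MonoidHom.comp_apply, ← Matrix.GeneralLinearGroup.map_comp, hφ, hs]

open Matrix in
/-- A finite criterion for `GL_m(R) → GL_m(F)` to be a split surjection. -/
theorem Matrix.GeneralLinearGroup.exists_section_of_bruhat {m R F : Type*} [Fintype m]
    [DecidableEq m] [CommRing R] [Field F] (ρ : R →+* F)
    {k l : ℕ} (υ : Fin k → GL m R) (τ : Fin l → GL m R) (w : GL m R)
    (hU1 : ∃ i, υ i = 1) (hU : ∀ i j, ∃ m, υ i * (υ j)⁻¹ = υ m)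
    (hT1 : ∃ i, τ i = 1) (hT : ∀ i j, ∃ m, τ i * (τ j)⁻¹ = τ m)
    (hTU : ∀ i j, ∃ m, τ i * υ j * (τ i)⁻¹ = υ m) (hw : w * w = 1)
    (hwT : ∀ i, ∃ m, w * τ i * w = τ m)
    (hwU : ∀ i, υ i = 1 ∨ ∃ a b d, w * υ i * w = υ a * τ b * w * υ d)
    (hρ : ∀ i j, map ρ (υ i * τ j) = 1 → υ i * τ j = 1)
    (hρw : ∀ i j, map ρ (υ i * τ j) ≠ map ρ w)
    (hdiag : ∀ D : m → F, (∀ i, D i ≠ 0) →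
      ∃ a b, (map ρ (υ a * τ b) : Matrix m m F) = diagonal D)
    (htrans : ∀ i j, i ≠ j → ∀ c,
      (∃ a b, (map ρ (υ a * τ b) : Matrix m m F) = transvection i j c) ∨
      ∃ a b d, (map ρ (υ a * τ b * w * υ d) : Matrix m m F) = transvection i j c) :
    ∃ s : GL m F →* GL m R, ∀ g, map ρ (s g) = g := by
  refine MonoidHom.exists_section_of_bruhat_fin _ υ τ w hU1 hU hT1 hT hTU hw hwT hwU hρ hρw
    fun K h₁ h₂ => eq_top_of_transvection_mem K (fun D hD => ?_) fun i j hij c => ?_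
  · obtain ⟨a, b, h⟩ := hdiag D hD
    exact ⟨_, h₁ a b, h⟩
  · rcases htrans i j hij c with ⟨a, b, h⟩ | ⟨a, b, d, h⟩
    exacts [⟨_, h₁ a b, h⟩, ⟨_, h₂ a b d, h⟩]

/-- An element of order two in the Weyl group of type `A₂`. -/
def glTwoTwoUnip : GL (Fin 2) ℤ :=
  ⟨!![-1, 1; 0, 1], !![-1, 1; 0, 1], by decide +kernel, by decide +kernel⟩

def glTwoTwoWeyl : GL (Fin 2) ℤ :=
  ⟨!![0, -1; -1, 0], !![0, -1; -1, 0], by decide +kernel, by decide +kernel⟩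

/-- GL_2(2) is the symmetric group S_3, and its reflection representation is integral. Here U has
order two and T is trivial. -/
theorem exists_section_GL_two_two : ∃ s : GL (Fin 2) (ZMod 2) →* GL (Fin 2) ℤ,
    ∀ g, Matrix.GeneralLinearGroup.map (Int.castRingHom (ZMod 2)) (s g) = g := by
  refine Matrix.GeneralLinearGroup.exists_section_of_bruhat _
    (fun i : Fin 2 => glTwoTwoUnip ^ (i : ℕ)) (fun _ : Fin 1 => 1) glTwoTwoWeyl
    ?_ ?_ ?_ ?_ ?_ ?_ ?_ ?_ ?_ ?_ ?_ ?_ <;> decide +kernel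

/-- For ω = (1 + √-7)/2, with ω² = ω - 2, this selects the prime above 2 at which ω reduces to 0. -/
theorem omega_sq_two : (0 : ZMod 2) * 0 = (-2 : ℤ) + (1 : ℤ) * 0 := by decide

/-- An element of order seven in a three-dimensional representation of `PSL₂(7)` over
`ℤ[(1 + √-7) / 2]`. -/
def glThreeTwoUnip : GL (Fin 3) (QuadraticAlgebra ℤ (-2) 1) :=
  ⟨!![-1, ⟨0, 1⟩, 1; -1, 1, 0; 0, 1, ⟨0, -1⟩],
    !![-1, ⟨0, 1⟩, 1; -1, 1, 0; 0, 1, ⟨0, -1⟩] ^ 6, by decide +kernel, by decide +kernel⟩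

def glThreeTwoTorus : GL (Fin 3) (QuadraticAlgebra ℤ (-2) 1) :=
  ⟨!![1, 0, 0; 1, -1, 1; ⟨1, -1⟩, -1, 0], !![1, 0, 0; 1, -1, 1; ⟨1, -1⟩, -1, 0] ^ 2,
    by decide +kernel, by decide +kernel⟩

def glThreeTwoWeyl : GL (Fin 3) (QuadraticAlgebra ℤ (-2) 1) :=
  ⟨!![-1, 0, 0; 0, -1, 0; ⟨0, 1⟩, -1, 1], !![-1, 0, 0; 0, -1, 0; ⟨0, 1⟩, -1, 1],
    by decide +kernel, by decide +kernel⟩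

/-- The Borel subgroup used is that of PSL_2(7) ≅ GL_3(2), not the triangular matrices: U has order
7, T has order 3, and 168 = 21 + 21 · 7. -/
theorem exists_section_GL_three_two :
    ∃ s : GL (Fin 3) (ZMod 2) →* GL (Fin 3) (QuadraticAlgebra ℤ (-2) 1),
      ∀ g, Matrix.GeneralLinearGroup.map (QuadraticAlgebra.evalRoot 0 omega_sq_two) (s g) = g := by
  refine Matrix.GeneralLinearGroup.exists_section_of_bruhat _
    (fun i : Fin 7 => glThreeTwoUnip ^ (i : ℕ)) (fun i : Fin 3 => glThreeTwoTorus ^ (i : ℕ))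
    glThreeTwoWeyl ?_ ?_ ?_ ?_ ?_ ?_ ?_ ?_ ?_ ?_ ?_ ?_ <;> decide +kernel

/-- This selects the prime of ℤ[√-2] above 3 at which √-2 reduces to 1. -/
theorem omega_sq_three : (1 : ZMod 3) * 1 = (-2 : ℤ) + (0 : ℤ) * 1 := by decide

/-- An element of order three in a two-dimensional representation of `GL₂(3)` over `ℤ[√-2]`. -/
def glTwoThreeUnip : GL (Fin 2) (QuadraticAlgebra ℤ (-2) 0) :=
  ⟨!![-2, ⟨-1, -1⟩; ⟨1, -1⟩, 1], !![-2, ⟨-1, -1⟩; ⟨1, -1⟩, 1] ^ 2,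
    by decide +kernel, by decide +kernel⟩

def glTwoThreeTorus : GL (Fin 2) (QuadraticAlgebra ℤ (-2) 0) :=
  ⟨!![-1, 0; ⟨1, -1⟩, 1], !![-1, 0; ⟨1, -1⟩, 1], by decide +kernel, by decide +kernel⟩

def glTwoThreeWeyl : GL (Fin 2) (QuadraticAlgebra ℤ (-2) 0) :=
  ⟨!![⟨-1, 1⟩, -2; ⟨-1, -1⟩, ⟨1, -1⟩], !![⟨-1, 1⟩, -2; ⟨-1, -1⟩, ⟨1, -1⟩],
    by decide +kernel, by decide +kernel⟩

theorem exists_section_GL_two_three :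
    ∃ s : GL (Fin 2) (ZMod 3) →* GL (Fin 2) (QuadraticAlgebra ℤ (-2) 0),
      ∀ g, Matrix.GeneralLinearGroup.map (QuadraticAlgebra.evalRoot 1 omega_sq_three) (s g)
        = g := by
  refine Matrix.GeneralLinearGroup.exists_section_of_bruhat _
    -- The Borel subgroup has order 3 · 4, and 48 = 12 + 12 · 3.
    (fun i : Fin 3 => glTwoThreeUnip ^ (i : ℕ))
    ![1, -1, glTwoThreeTorus, -glTwoThreeTorus] glTwoThreeWeyl
    ?_ ?_ ?_ ?_ ?_ ?_ ?_ ?_ ?_ ?_ ?_ ?_ <;> decide +kernel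

end Sections

/-! ### Split reductions from ℤ/p^n to ℤ/p. -/

section Lifts

theorem reductionSplits_two_two (n : ℕ) (h : 2 ∣ 2 ^ n) : ReductionSplits 2 n 2 h :=
  .of_ring (Int.castRingHom _) (Int.castRingHom _) (RingHom.ext_int _ _) exists_section_GL_two_two

theorem exists_root_two_adic (n : ℕ) : ∃ a : ℤ, (2 : ℤ) ^ n ∣ a * a - a + 2 ∧ 2 ∣ a := by
  induction n with
  | zero => exact ⟨0, by simp, by simp⟩
  | succ n ih =>
    obtain ⟨a, ⟨t, ht⟩, b, rfl⟩ := ih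
    rcases n with _ | n
    · exact ⟨0, by simp, by simp⟩
    -- Newton's step for f(a) = a² - a + 2: since f'(a) ≡ -1 modulo 2, the correction is a + f(a) =
    -- a² + 2.
    · refine ⟨2 * b * (2 * b) + 2, ⟨2 * b * t + 2 ^ n * t ^ 2, ?_⟩, ⟨b * (2 * b) + 1, by ring⟩⟩
      have h : 2 * b * (2 * b) + 2 = 2 * b + 2 ^ (n + 1) * t := by linear_combination ht
      rw [h]
      linear_combination ht

theorem exists_root_three_adic (n : ℕ) : ∃ a : ℤ, (3 : ℤ) ^ n ∣ a * a + 2 ∧ 3 ∣ a - 1 := by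
  induction n with
  | zero => exact ⟨1, by simp, by simp⟩
  | succ n ih =>
    obtain ⟨a, ⟨t, ht⟩, b, hb⟩ := ih
    obtain rfl : a = 3 * b + 1 := by linarith
    rcases n with _ | n
    · exact ⟨1, by simp, by simp⟩
    -- Newton's step a + f(a) again, for f(a) = a² + 2, as f'(a) = 2a ≡ -1 modulo 3.
    · refine ⟨3 * b + 1 + 3 ^ (n + 1) * t, ⟨t * (1 + 2 * b) + 3 ^ n * t ^ 2, ?_⟩,
        ⟨b + 3 ^ n * t, by ring⟩⟩
      linear_combination ht

theorem ReductionSplits.of_evalRoot {p n r : ℕ} {h : p ∣ p ^ n} {a b : ℤ} {u : ZMod p}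
    (hu : u * u = a + b * u) (v : ℤ) (hv : ((p ^ n : ℕ) : ℤ) ∣ v * v - (a + b * v))
    (hvu : (v : ZMod p) = u)
    (hs : ∃ s : GL (Fin r) (ZMod p) →* GL (Fin r) (QuadraticAlgebra ℤ a b),
      ∀ g, Matrix.GeneralLinearGroup.map (QuadraticAlgebra.evalRoot u hu) (s g) = g) :
    ReductionSplits p n r h := by
  have hv' : (v * v : ZMod (p ^ n)) = a + b * v := by
    rw [← ZMod.intCast_zmod_eq_zero_iff_dvd] at hv
    push_cast at hv
    exact sub_eq_zero.1 hv
  refine .of_ring _ (QuadraticAlgebra.evalRoot (v : ZMod (p ^ n)) hv') (RingHom.ext fun x => ?_) hs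
  change ZMod.castHom h (ZMod p) ((x.re : ZMod (p ^ n)) + x.im * v) = x.re + x.im * u
  rw [map_add, map_mul, map_intCast, map_intCast, map_intCast, hvu]

theorem reductionSplits_three_two (n : ℕ) (h : 2 ∣ 2 ^ n) : ReductionSplits 2 n 3 h := by
  obtain ⟨v, hv, hv2⟩ := exists_root_two_adic n
  refine .of_evalRoot _ v ?_ ((ZMod.intCast_zmod_eq_zero_iff_dvd _ _).2 (by exact_mod_cast hv2))
    exists_section_GL_three_two
  convert hv using 1
  · rfl
  · ring

theorem reductionSplits_two_three (n : ℕ) (h : 3 ∣ 3 ^ n) : ReductionSplits 3 n 2 h := by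
  obtain ⟨v, hv, hv3⟩ := exists_root_three_adic n
  refine .of_evalRoot _ v ?_ ?_ exists_section_GL_two_three
  · convert hv using 1
    · rfl
    · ring
  · rw [← sub_eq_zero]
    exact_mod_cast (ZMod.intCast_zmod_eq_zero_iff_dvd (v - 1) 3).2 (by exact_mod_cast hv3)

/-- The Teichmüller lift. -/
def teichmullerLift (p n : ℕ) [hp : Fact p.Prime] : ZMod p →* ZMod (p ^ (n + 1)) where
  toFun x := (x.val : ZMod (p ^ (n + 1))) ^ p ^ n
  map_one' := by rw [ZMod.val_one, Nat.cast_one, one_pow]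
  map_mul' x y := by
    rw [← mul_pow, ← Nat.cast_mul, ← sub_eq_zero]
    -- A congruence modulo p becomes one modulo p^(n+1) after raising to the power p^n.
    have h := dvd_sub_pow_of_dvd_sub (R := ℤ) (p := p) (a := (x * y).val) (b := x.val * y.val)
      (by
        rw [← ZMod.intCast_zmod_eq_zero_iff_dvd]
        simp) n
    rw [← Nat.cast_pow, ← ZMod.intCast_zmod_eq_zero_iff_dvd] at h
    exact_mod_cast h

theorem castHom_teichmullerLift (p n : ℕ) [Fact p.Prime] (h : p ∣ p ^ (n + 1)) (x : ZMod p) :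
    ZMod.castHom h (ZMod p) (teichmullerLift p n x) = x := by
  change ZMod.castHom h (ZMod p) ((x.val : ZMod (p ^ (n + 1))) ^ p ^ n) = x
  rw [map_pow, map_natCast, ZMod.natCast_zmod_val, ZMod.pow_card_pow]

theorem reductionSplits_one {p n : ℕ} [Fact p.Prime] (hn : 1 ≤ n) (h : p ∣ p ^ n) :
    ReductionSplits p n 1 h := by
  obtain ⟨n, rfl⟩ := Nat.exists_eq_add_of_le' hn
  let e (R : Type) [CommRing R] : GL (Fin 1) R ≃* Rˣ := Units.mapEquiv Matrix.uniqueRingEquiv.toMulEquiv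
  refine ⟨(e _).symm.toMonoidHom.comp ((Units.map (teichmullerLift p n)).comp (e _).toMonoidHom),
    fun g => Units.ext (Matrix.ext fun i j => ?_)⟩
  rw [Subsingleton.elim i default, Subsingleton.elim j default]
  exact castHom_teichmullerLift p n h (g default default)

theorem reductionSplits_exponent_one {p r : ℕ} (h : p ∣ p ^ 1) : ReductionSplits p 1 r h := by
  refine ⟨Matrix.GeneralLinearGroup.map (ZMod.castHom (pow_one p).dvd (ZMod (p ^ 1))), fun g => ?_⟩
  rw [← MonoidHom.comp_apply, ← Matrix.GeneralLinearGroup.map_comp]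
  rw [show (ZMod.castHom h (ZMod p)).comp (ZMod.castHom (pow_one p).dvd (ZMod (p ^ 1))) =
    RingHom.id _ from RingHom.ext_zmod _ _]
  exact Units.ext (Matrix.ext fun _ _ => rfl)

end Lifts

/-! ### Endomorphisms of homocyclic groups as matrices. -/

section Matrices

variable {A : Type*} [AddCommGroup A]

/-- Endomorphisms of a homocyclic group are matrices over `ℤ/N`. -/
def endOfMatrix {N r : ℕ} (e : A ≃+ (Fin r → ZMod N)) :
    Matrix (Fin r) (Fin r) (ZMod N) ≃+* AddMonoid.End A where
  toFun M := e.symm.toAddMonoidHom.comp ((Matrix.toLin' M).toAddMonoidHom.comp e.toAddMonoidHom)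
  invFun f := LinearMap.toMatrix' ((e.toAddMonoidHom.comp
    (AddMonoidHom.comp f e.symm.toAddMonoidHom)).toZModLinearMap N)
  left_inv M := by
    rw [← LinearEquiv.eq_symm_apply]
    refine LinearMap.ext fun v => ?_
    simp
  right_inv f := by
    refine AddMonoidHom.ext fun x => ?_
    simp only [Matrix.toLin'_toMatrix']
    change e.symm (e (f (e.symm (e x)))) = f x
    rw [e.symm_apply_apply, e.symm_apply_apply]
  map_mul' M M' := by
    refine AddMonoidHom.ext fun x => ?_
    change e.symm ((M * M').mulVec (e x)) =
      e.symm (M.mulVec (e (e.symm (M'.mulVec (e x)))))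
    rw [e.apply_symm_apply, Matrix.mulVec_mulVec]
  map_add' M M' := by
    refine AddMonoidHom.ext fun x => ?_
    change e.symm ((M + M').mulVec (e x)) = e.symm (M.mulVec (e x)) + e.symm (M'.mulVec (e x))
    rw [Matrix.add_mulVec, map_add]

theorem apply_endOfMatrix {N r : ℕ} (e : A ≃+ (Fin r → ZMod N))
    (M : Matrix (Fin r) (Fin r) (ZMod N)) (x : A) : e (endOfMatrix e M x) = M.mulVec (e x) :=
  e.apply_symm_apply _

theorem IsHomocyclic.exists_quotient_equiv {p n r : ℕ} [hp : Fact p.Prime] (h : p ∣ p ^ n)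
    (e : A ≃+ (Fin r → ZMod (p ^ n))) :
    ∃ q : A ⧸ pMultiples p A ≃+ (Fin r → ZMod p),
      ∀ x : A, q x = fun k => ZMod.castHom h (ZMod p) (e x k) := by
  have : NeZero (p ^ n) := ⟨pow_ne_zero _ hp.out.ne_zero⟩
  let f : A →+ (Fin r → ZMod p) :=
    ((ZMod.castHom h (ZMod p)).toAddMonoidHom.compLeft (Fin r)).comp e.toAddMonoidHom
  have hf : Function.Surjective f := fun v => by
    obtain ⟨w, hw⟩ := (ZMod.castHom_surjective h).comp_left v
    exact ⟨e.symm w, by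
      rw [← hw]
      change ZMod.castHom h (ZMod p) ∘ e (e.symm w) = _
      rw [e.apply_symm_apply]⟩
  have hker : pMultiples p A = f.ker := by
    refine le_antisymm ?_ fun x hx => ?_
    · rintro _ ⟨y, rfl⟩
      rw [AddMonoidHom.mem_ker]
      funext k
      change f (p • y) k = 0
      rw [map_nsmul, Pi.smul_apply, nsmul_eq_mul, CharP.cast_eq_zero, zero_mul]
    · have key : ∀ k, ∃ z : ZMod (p ^ n), p • z = e x k := by
        intro k
        have h1 : ZMod.castHom h (ZMod p) (e x k) = 0 := congrFun hx k
        rw [← ZMod.natCast_zmod_val (e x k), map_natCast, ZMod.natCast_eq_zero_iff] at h1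
        obtain ⟨c, hc⟩ := h1
        refine ⟨(c : ZMod (p ^ n)), ?_⟩
        rw [← ZMod.natCast_zmod_val (e x k), hc, nsmul_eq_mul, Nat.cast_mul]
      choose z hz using key
      refine ⟨e.symm z, e.injective ?_⟩
      change e (p • e.symm z) = e x
      rw [map_nsmul, e.apply_symm_apply]
      exact funext hz
  exact ⟨(QuotientAddGroup.quotientAddEquivOfEq hker).trans
    (QuotientAddGroup.quotientKerEquivOfSurjective f hf), fun x => rfl⟩

theorem mk_endOfMatrix {p n r : ℕ} (h : p ∣ p ^ n) (e : A ≃+ (Fin r → ZMod (p ^ n)))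
    (q : A ⧸ pMultiples p A ≃+ (Fin r → ZMod p))
    (hq : ∀ x : A, q x = fun k => ZMod.castHom h (ZMod p) (e x k))
    (M : Matrix (Fin r) (Fin r) (ZMod (p ^ n))) (x : A) :
    (endOfMatrix e M x : A ⧸ pMultiples p A) =
      endOfMatrix q (M.map (ZMod.castHom h (ZMod p))) x := by
  apply q.injective
  rw [apply_endOfMatrix, hq, hq, apply_endOfMatrix]
  funext k
  exact RingHom.map_mulVec _ _ _ _

theorem exists_units_equiv_endOfMatrix {N r : ℕ} (e : A ≃+ (Fin r → ZMod N)) :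
    ∃ E : GL (Fin r) (ZMod N) ≃* (AddMonoid.End A)ˣ,
      ∀ g, (E g : AddMonoid.End A) = endOfMatrix e (g : Matrix (Fin r) (Fin r) (ZMod N)) :=
  ⟨Units.mapEquiv (endOfMatrix e).toMulEquiv, fun _ => rfl⟩

/-- If reduction splits for matrices then it splits for automorphisms of a homocyclic group. -/
theorem ReductionSplits.exists_units_lift {p n r : ℕ} [Fact p.Prime] {h : p ∣ p ^ n}
    (hs : ReductionSplits p n r h) (hA : IsHomocyclic p n r A) :
    ∃ s : (AddMonoid.End (A ⧸ pMultiples p A))ˣ →* (AddMonoid.End A)ˣ, ∀ u x,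
      (((s u : AddMonoid.End A) x : A) : A ⧸ pMultiples p A) =
        (u : AddMonoid.End (A ⧸ pMultiples p A)) x := by
  obtain ⟨e⟩ := hA
  obtain ⟨q, hq⟩ := IsHomocyclic.exists_quotient_equiv h e
  obtain ⟨s, hs⟩ := hs
  obtain ⟨E, hE⟩ := exists_units_equiv_endOfMatrix q
  obtain ⟨E', hE'⟩ := exists_units_equiv_endOfMatrix e
  refine ⟨E'.toMonoidHom.comp (s.comp E.symm.toMonoidHom), fun u x => ?_⟩
  obtain ⟨g, rfl⟩ := E.surjective u
  have h1 : (s g : Matrix (Fin r) (Fin r) (ZMod (p ^ n))).map (ZMod.castHom h (ZMod p)) =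
      (g : Matrix (Fin r) (Fin r) (ZMod p)) := congrArg Units.val (hs g)
  simp only [MonoidHom.comp_apply, MulEquiv.coe_toMonoidHom, E.symm_apply_apply, hE, hE']
  rw [mk_endOfMatrix h e q hq, h1]

theorem IsHomocyclic.nonempty_GL_mulEquiv {p n r : ℕ} [Fact p.Prime] (hn : 1 ≤ n)
    (hA : IsHomocyclic p n r A) :
    Nonempty (GL (Fin r) (ZMod p) ≃* (AddMonoid.End (A ⧸ pMultiples p A))ˣ) := by
  obtain ⟨e⟩ := hA
  obtain ⟨q, -⟩ := IsHomocyclic.exists_quotient_equiv (dvd_pow_self p (by omega)) e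
  exact ⟨(exists_units_equiv_endOfMatrix q).choose⟩

end Matrices

/-! ### Sufficiency: block diagonal complements. -/

section Diagonal

variable {ι : Type*} [LinearOrder ι] {p : ℕ} {n r : ι → ℕ}
  {G : ι → Type*} [∀ i, AddCommGroup (G i)]

/-- Block diagonal endomorphisms. -/
def blockDiag (G : ι → Type*) [∀ i, AddCommGroup (G i)] :
    ((i : ι) → AddMonoid.End (G i)) →* AddMonoid.End (⨁ i, G i) where
  toFun f := DirectSum.map f
  map_one' := DirectSum.map_id
  map_mul' f g := DirectSum.map_comp g f

theorem diagBlock_blockDiag (f : (i : ι) → AddMonoid.End (G i)) (i : ι) (x : G i) :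
    diagBlock (blockDiag G f) i x = f i x := by
  exact (congrArg (fun z => z i) (DirectSum.map_of f i x)).trans (DirectSum.of_eq_same _ _)

theorem isSemidirectProductBy_of_reductionSplits [Fact p.Prime] (hn_pos : ∀ i, 1 ≤ n i)
    (hn : StrictMono n) (hG : ∀ i, IsHomocyclic p (n i) (r i) (G i))
    (hs : ∀ i, ReductionSplits p (n i) (r i) (dvd_pow_self p (by have := hn_pos i; omega))) :
    IsSemidirectProductBy (Delta hn hG) ((i : ι) → GL (Fin (r i)) (ZMod p)) := by
  choose s hs using fun i => (hs i).exists_units_lift (hG i)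
  refine isSemidirectProductBy_ker (sigma hn hG)
    ((Units.map (blockDiag G)).comp (MulEquiv.piUnits.symm.toMonoidHom.comp (MonoidHom.pi fun i =>
      (s i).comp (Pi.evalMonoidHom _ i)))) (fun b => ?_)
    (MulEquiv.piCongrRight fun i => ((hG i).nonempty_GL_mulEquiv (hn_pos i)).some)
  refine funext fun i => Units.ext (AddMonoidHom.ext fun x => ?_)
  induction x using QuotientAddGroup.induction_on with
  | H x =>
    refine Eq.trans ?_ (hs i (b i) x)
    exact congrArg QuotientAddGroup.mk (diagBlock_blockDiag _ i x)

end Diagonal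

/-! ### Necessity for p ≥ 5: the layers of the socle. -/

section Layers

/-- The elements of order dividing `p` that are divisible by `p ^ k`. -/
def socleLayer (p k : ℕ) (A : Type*) [AddCommGroup A] : AddSubgroup A :=
  (nsmulAddMonoidHom (α := A) p).ker ⊓ (nsmulAddMonoidHom (α := A) (p ^ k)).range

variable {A : Type*} [AddCommGroup A] {p : ℕ}

theorem mem_socleLayer {k : ℕ} {x : A} :
    x ∈ socleLayer p k A ↔ p • x = 0 ∧ ∃ y, p ^ k • y = x := Iff.rfl

theorem map_mem_socleLayer {k : ℕ} {x : A} (f : A →+ A) (hx : x ∈ socleLayer p k A) :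
    f x ∈ socleLayer p k A := by
  obtain ⟨h, y, rfl⟩ := mem_socleLayer.1 hx
  exact mem_socleLayer.2 ⟨by rw [← map_nsmul, h, map_zero], f y, by rw [map_nsmul]⟩

theorem IsHomocyclic.exists_pow_nsmul_eq {n r : ℕ} [Fact p.Prime] (h : IsHomocyclic p n r A)
    {a m : ℕ} (hm : m + a ≤ n) {x : A} (hx : p ^ m • x = 0) : ∃ w, p ^ a • w = x := by
  induction a generalizing m x with
  | zero => exact ⟨x, by rw [pow_zero, one_smul]⟩
  | succ a ih =>
    obtain ⟨y, rfl⟩ := h.mem_pMultiples (by omega) hx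
    obtain ⟨w, rfl⟩ := ih (m := m + 1) (x := y) (by omega) (by rw [pow_succ, mul_smul]; exact hx)
    exact ⟨w, by rw [pow_succ', mul_smul]; rfl⟩

theorem IsHomocyclic.pow_nsmul_of_le {n r k : ℕ} (h : IsHomocyclic p n r A) (hk : n ≤ k) (x : A) :
    p ^ k • x = 0 := by
  rw [← Nat.sub_add_cancel hk, pow_add, mul_smul, h.pow_nsmul, smul_zero]

/-- Unipotent elements of order `p ≥ 5` with small layer components act trivially on a layer. -/
theorem apply_mem_socleLayer_of_pow_eq_one (hp : p.Prime) (hp5 : 5 ≤ p) (k : ℕ)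
    (N : AddMonoid.End A) (hN : (N + 1) ^ p = 1)
    (h₀ : ∀ x ∈ socleLayer p k A, N x ∈ socleLayer p (k + 1) A)
    (h₁ : ∀ x ∈ socleLayer p (k + 1) A, N (N x) ∈ socleLayer p (k + 2) A)
    (h₂ : ∀ x ∈ socleLayer p (k + 2) A, N x ∈ socleLayer p (k + 3) A)
    {x : A} (hx : x ∈ socleLayer p (k + 1) A) : N x ∈ socleLayer p (k + 2) A := by
  obtain ⟨hpx, y, rfl⟩ := mem_socleLayer.1 hx
  set D : AddSubgroup A := (nsmulAddMonoidHom (α := A) (p ^ (k + 2))).range with hD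
  have hDN : ∀ z ∈ D, N z ∈ D := by
    rintro _ ⟨z, rfl⟩
    exact ⟨N z, (map_nsmul N _ _).symm⟩
  have hleD : ∀ z ∈ socleLayer p (k + 2) A, z ∈ D := fun z hz => hz.2
  -- On `p ^ k A [p ^ 2]` modulo `p ^ (k + 2) A`, the endomorphism `N` maps the socle into the
  -- multiples of `p`.
  have step : ∀ v : A, p • p • p ^ k • v = 0 → p • p ^ k • v ∈ D →
      ∃ u ∈ socleLayer p (k + 1) A, ∃ d ∈ D, N (p ^ k • v) = u + d := by
    rintro v hv ⟨z, hz⟩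
    have hz' : p ^ (k + 2) • z = p • p ^ k • v := hz
    have e1 : p • p ^ (k + 1) • z = p ^ (k + 2) • z := by rw [← mul_smul]; ring_nf
    have hb : p ^ k • v - p ^ (k + 1) • z ∈ socleLayer p k A :=
      mem_socleLayer.2 ⟨by rw [smul_sub, e1, hz', sub_self], v - p • z, by
        rw [smul_sub, ← mul_smul, pow_succ]⟩
    have ha : p ^ (k + 2) • z ∈ socleLayer p (k + 2) A :=
      mem_socleLayer.2 ⟨by rw [hz', hv], z, rfl⟩
    obtain ⟨-, t, ht⟩ := mem_socleLayer.1 (h₂ _ ha)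
    have hc : N (p ^ (k + 1) • z) - p ^ (k + 2) • t ∈ socleLayer p (k + 1) A :=
      mem_socleLayer.2 ⟨by
        rw [smul_sub, ← map_nsmul, e1, ← ht, ← mul_smul, ← pow_succ', sub_self], N z - p • t, by
        rw [smul_sub, ← mul_smul, ← pow_succ, map_nsmul]⟩
    refine ⟨_, add_mem (h₀ _ hb) hc, _, ⟨t, rfl⟩, ?_⟩
    change _ = _ + _ + p ^ (k + 2) • t
    rw [map_sub]
    abel
  have hv : p • p • p ^ k • y = 0 := by
    rw [← hpx, ← mul_smul p (p ^ k), ← pow_succ']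
  have hsq : p • N (N (p ^ k • y)) ∈ D := by
    rw [← map_nsmul, ← map_nsmul, ← mul_smul, ← pow_succ']
    exact hleD _ (h₁ _ hx)
  -- By `hsq`, N² moves p^k y into the socle modulo D. By `step`, a third N moves it into layer k +
  -- 1 modulo D, and by `h₁` two more move it into D.
  have h5 : N (N (N (N (N (p ^ k • y))))) ∈ D := by
    have e : p ^ k • N (N y) = N (N (p ^ k • y)) := by rw [map_nsmul, map_nsmul]
    obtain ⟨u, hu, d, hd, he⟩ := step (N (N y))
      (by rw [e, ← map_nsmul N, ← map_nsmul N, ← map_nsmul N, ← map_nsmul N, hv, map_zero, map_zero])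
      (by rwa [e])
    rw [e] at he
    rw [he, map_add, map_add]
    exact add_mem (hleD _ (h₁ u hu)) (hDN _ (hDN _ hd))
  have hpow : ∀ j, (N ^ (j + 5)) (p ^ k • y) ∈ D := by
    intro j
    induction j with
    | zero => exact h5
    | succ j ih =>
      have : N ^ (j + 1 + 5) = N * N ^ (j + 5) := by rw [← pow_succ']
      rw [this]
      exact hDN _ ih
  have hpow' : ∀ j, p • (N ^ (j + 2)) (p ^ k • y) ∈ D := by
    intro j
    induction j with
    | zero => exact hsq
    | succ j ih =>
      have : N ^ (j + 1 + 2) = N * N ^ (j + 2) := by rw [← pow_succ']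
      rw [this]
      have := hDN _ ih
      rwa [map_nsmul] at this
  have hterm : ∀ m c : ℕ, (N ^ m * 1 ^ (p - m) * (c : AddMonoid.End A)) (p ^ k • y) =
      c • (N ^ m) (p ^ k • y) := by
    intro m c
    rw [one_pow, mul_one, ← map_nsmul, ← AddMonoid.End.natCast_apply]
    rfl
  have hsum : p ^ k • y =
      ∑ m ∈ Finset.range (p + 1), p.choose m • (N ^ m) (p ^ k • y) := by
    have h := congrArg (fun f : AddMonoid.End A => f (p ^ k • y))
      ((Commute.one_right N).add_pow p)
    rw [hN] at h
    refine h.trans ((AddMonoidHom.finsetSum_apply _ _ _).trans ?_)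
    exact Finset.sum_congr rfl fun m _ => hterm m _
  obtain ⟨q, rfl⟩ : ∃ q, p = q + 2 := ⟨p - 2, by omega⟩
  rw [Finset.sum_range_succ', Finset.sum_range_succ', Nat.choose_zero_right, one_smul] at hsum
  -- In the expansion of (1 + N)^p = 1 the terms of degree 2 to p - 1 are in D because p divides the
  -- binomial coefficient and `hpow'` applies. The top term N^p is in D because p ≥ 5. So the linear
  -- term is in D as well, and it equals N x.
  have hlin : (q + 2) • N ((q + 2) ^ k • y) ∈ D := by
    have h0 : ∑ m ∈ Finset.range (q + 1), (q + 2).choose (m + 1 + 1) •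
        (N ^ (m + 1 + 1)) ((q + 2) ^ k • y) + (q + 2) • N ((q + 2) ^ k • y) = 0 := by
      have e0 : (N ^ 0) ((q + 2) ^ k • y) = (q + 2) ^ k • y := by rw [pow_zero]; rfl
      rw [e0, zero_add, pow_one, Nat.choose_one_right] at hsum
      exact add_eq_right.1 hsum.symm
    rw [← neg_eq_iff_add_eq_zero] at h0
    rw [← h0]
    refine neg_mem (sum_mem fun m hm => ?_)
    rw [Finset.mem_range] at hm
    rcases Nat.lt_or_ge m q with h | h
    · obtain ⟨c, hc⟩ := hp.dvd_choose_self (k := m + 1 + 1) (by omega) (by omega)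
      rw [hc, mul_comm, mul_smul]
      exact nsmul_mem (hpow' m) c
    · obtain ⟨j, rfl⟩ : ∃ j, m = j + 3 := ⟨m - 3, by omega⟩
      exact nsmul_mem (hpow j) _
  rw [← map_nsmul, ← mul_smul, ← pow_succ'] at hlin
  exact mem_socleLayer.2 ⟨by rw [← map_nsmul, hpx, map_zero], hlin⟩

end Layers

section Levels

variable {ι : Type*} [LinearOrder ι] {p : ℕ} {n r : ι → ℕ}
  {G : ι → Type*} [∀ i, AddCommGroup (G i)]

/-- An endomorphism whose diagonal block at the level `k + 1` vanishes modulo `p` shifts the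
`k`-th socle layer. -/
theorem apply_mem_socleLayer_succ [Fact p.Prime] (hn : StrictMono n)
    (hG : ∀ i, IsHomocyclic p (n i) (r i) (G i)) (C : (⨁ i, G i) →+ (⨁ i, G i)) (k : ℕ)
    (hC : ∀ j, n j = k + 1 → ∀ x, diagBlock C j x ∈ pMultiples p (G j))
    {x : ⨁ i, G i} (hx : x ∈ socleLayer p k (⨁ i, G i)) :
    C x ∈ socleLayer p (k + 1) (⨁ i, G i) := by
  classical
  obtain ⟨hpx, y, rfl⟩ := mem_socleLayer.1 hx
  refine mem_socleLayer.2 ⟨by rw [← map_nsmul, hpx, map_zero], ?_⟩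
  suffices h : ∀ j, C (DirectSum.of G j ((p ^ k • y) j)) ∈
      (nsmulAddMonoidHom (α := ⨁ i, G i) (p ^ (k + 1))).range by
    change C (p ^ k • y) ∈ (nsmulAddMonoidHom (α := ⨁ i, G i) (p ^ (k + 1))).range
    rw [← DirectSum.sum_support_of (p ^ k • y), map_sum]
    exact sum_mem fun j _ => h j
  intro j
  have hpj : p ^ 1 • (p ^ k • y) j = 0 := by
    rw [pow_one]
    exact DFunLike.congr_fun hpx j
  have hyj : (p ^ k • y) j = p ^ k • y j := rfl
  -- Components with n_j ≤ k vanish, and those with n_j > k + 1 are already divisible by p^(k+1)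
  -- because p kills them. Only n_j = k + 1 involves the hypothesis on C.
  rcases lt_trichotomy (n j) (k + 1) with h | h | h
  · have : (p ^ k • y) j = 0 := by
      rw [hyj, (hG j).pow_nsmul_of_le (Nat.lt_succ_iff.1 h)]
    rw [this, map_zero, map_zero]
    exact zero_mem _
  · set z := C (DirectSum.of G j (y j)) with hz
    have hpz : p ^ (k + 1) • z = 0 := by
      rw [hz, ← h, ← map_nsmul, ← map_nsmul, (hG j).pow_nsmul, map_zero, map_zero]
    rw [hyj, map_nsmul, map_nsmul, ← hz, ← DirectSum.sum_support_of z, Finset.smul_sum]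
    refine sum_mem fun l _ => ?_
    have hl : n l < k + 1 ∨ z l ∈ pMultiples p (G l) := by
      rcases lt_trichotomy (n l) (k + 1) with h' | h' | h'
      · exact .inl h'
      · obtain rfl : l = j := hn.injective (h'.trans h.symm)
        exact .inr (hC l h (y l))
      · exact .inr ((hG l).mem_pMultiples h' (DFunLike.congr_fun hpz l))
    rcases hl with h' | ⟨w, hw⟩
    · rw [← map_nsmul, (hG l).pow_nsmul_of_le (Nat.lt_succ_iff.1 h'), map_zero]
      exact zero_mem _
    · refine ⟨DirectSum.of G l w, ?_⟩
      rw [← hw]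
      change p ^ (k + 1) • DirectSum.of G l w = p ^ k • DirectSum.of G l (p • w)
      rw [map_nsmul, ← mul_smul, pow_succ]
  · obtain ⟨w, hw⟩ := (hG j).exists_pow_nsmul_eq (a := k + 1) (by omega) hpj
    refine ⟨C (DirectSum.of G j w), ?_⟩
    rw [← hw, map_nsmul, map_nsmul]
    rfl

end Levels

/-! ### Congruences modulo Δ(G), and transvections of a summand. -/

section Delta

variable {ι : Type*} [LinearOrder ι] {p : ℕ} {n r : ι → ℕ}
  {G : ι → Type*} [∀ i, AddCommGroup (G i)] [Fact p.Prime] (hn : StrictMono n)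
  (hG : ∀ i, IsHomocyclic p (n i) (r i) (G i))

theorem inv_mul_mem_Delta_iff {g h : (AddMonoid.End (⨁ i, G i))ˣ} :
    g⁻¹ * h ∈ Delta hn hG ↔ ∀ j x,
      diagBlock (h : AddMonoid.End (⨁ i, G i)) j x -
        diagBlock (g : AddMonoid.End (⨁ i, G i)) j x ∈ pMultiples p (G j) := by
  rw [Delta, MonoidHom.mem_ker, map_mul, map_inv, inv_mul_eq_one]
  have key : ∀ j x, diagBlock (h : AddMonoid.End (⨁ i, G i)) j x -
        diagBlock (g : AddMonoid.End (⨁ i, G i)) j x ∈ pMultiples p (G j) ↔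
      diagBlockMod p (g : AddMonoid.End (⨁ i, G i)) j x =
        diagBlockMod p (h : AddMonoid.End (⨁ i, G i)) j x := fun j x => by
    rw [← neg_add_eq_sub]
    exact QuotientAddGroup.eq.symm
  simp only [key]
  refine ⟨fun he j x => ?_, fun he => funext fun j => Units.ext (AddMonoidHom.ext fun x => ?_)⟩
  · exact congrArg (fun u : (AddMonoid.End (G j ⧸ pMultiples p (G j)))ˣ =>
      (u : AddMonoid.End (G j ⧸ pMultiples p (G j))) x) (congrFun he j)
  · induction x using QuotientAddGroup.induction_on with
    | H x => exact he j x

theorem mem_Delta_iff {h : (AddMonoid.End (⨁ i, G i))ˣ} :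
    h ∈ Delta hn hG ↔ ∀ j x, diagBlock (h : AddMonoid.End (⨁ i, G i)) j x - x ∈
      pMultiples p (G j) := by
  have := inv_mul_mem_Delta_iff hn hG (g := 1) (h := h)
  rw [inv_one, one_mul] at this
  rw [this]
  refine forall₂_congr fun j x => ?_
  have : diagBlock ((1 : (AddMonoid.End (⨁ i, G i))ˣ) : AddMonoid.End (⨁ i, G i)) j x = x :=
    DirectSum.of_eq_same _ _
  rw [this]

end Delta

section SingleBlock

variable {ι : Type*} [LinearOrder ι] {G : ι → Type*} [∀ i, AddCommGroup (G i)]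

/-- Extension by zero of an endomorphism of a summand. -/
def singleBlock (i : ι) (f : AddMonoid.End (G i)) : AddMonoid.End (⨁ i, G i) :=
  (DirectSum.of G i).comp (AddMonoidHom.comp f (DFinsupp.evalAddMonoidHom i))

theorem singleBlock_apply (i : ι) (f : AddMonoid.End (G i)) (x : ⨁ i, G i) :
    singleBlock i f x = DirectSum.of G i (f (x i)) := rfl

theorem singleBlock_mul_self {i : ι} {f : AddMonoid.End (G i)} (hf : f * f = 0) :
    singleBlock i f * singleBlock i f = 0 := by
  refine AddMonoidHom.ext fun x => ?_
  change singleBlock i f (singleBlock i f x) = 0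
  rw [singleBlock_apply, singleBlock_apply, DirectSum.of_eq_same]
  exact (congrArg (DirectSum.of G i) (DFunLike.congr_fun hf (x i))).trans (map_zero _)

theorem diagBlock_singleBlock_of_ne {i j : ι} (h : j ≠ i) (f : AddMonoid.End (G i)) (x : G j) :
    diagBlock (singleBlock i f) j x = 0 :=
  DirectSum.of_eq_of_ne _ _ _ h

end SingleBlock

section Units

/-- The unit `1 + e` for an element `e` of square zero. -/
def unitOfSqZero {R : Type*} [Ring R] (e : R) (he : e * e = 0) : Rˣ where
  val := 1 + e
  inv := 1 - e
  val_inv := by rw [add_mul, mul_sub, mul_sub, he]; simp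
  inv_val := by rw [sub_mul, mul_add, mul_add, he]; simp

theorem val_unitOfSqZero {R : Type*} [Ring R] (e : R) (he : e * e = 0) :
    (unitOfSqZero e he : R) = 1 + e := rfl

theorem val_unitOfSqZero_pow {R : Type*} [Ring R] (e : R) (he : e * e = 0) (m : ℕ) :
    ((unitOfSqZero e he ^ m : Rˣ) : R) = 1 + m • e := by
  induction m with
  | zero => simp
  | succ m ih =>
    rw [pow_succ, Units.val_mul, ih, val_unitOfSqZero, mul_add, mul_one, add_mul, one_mul,
      smul_mul_assoc, he, smul_zero, add_zero, succ_nsmul, add_assoc]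

end Units

/-! ### The rank bound for p ≥ 5. -/

section LargePrime

variable {ι : Type*} [LinearOrder ι] {p : ℕ} {n r : ι → ℕ}
  {G : ι → Type*} [∀ i, AddCommGroup (G i)]

theorem IsSemidirectProductBy.rank_le_one [hp : Fact p.Prime] (hp5 : 5 ≤ p) (hn : StrictMono n)
    (hG : ∀ i, IsHomocyclic p (n i) (r i) (G i)) {Q : Type*} [Group Q]
    (h : IsSemidirectProductBy (Delta hn hG) Q) (i : ι) (hi : 2 ≤ n i) : r i ≤ 1 := by
  by_contra! hr
  obtain ⟨k, hk⟩ : ∃ k, n i = k + 2 := ⟨n i - 2, by omega⟩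
  obtain ⟨s, hs, hs1⟩ := h.exists_retraction
  obtain ⟨e⟩ := hG i
  let a : Fin (r i) := ⟨0, by omega⟩
  let b : Fin (r i) := ⟨1, by omega⟩
  have hab : b ≠ a := by simp [a, b, Fin.ext_iff]
  let f : AddMonoid.End (G i) := endOfMatrix e (Matrix.single a b 1)
  have hf : f * f = 0 := by
    rw [← map_mul, Matrix.single_mul_single_of_ne _ _ _ _ hab, map_zero]
  let E : AddMonoid.End (⨁ i, G i) := singleBlock i f
  have hE : E * E = 0 := singleBlock_mul_self hf
  let T := unitOfSqZero E hE
  -- T^p = 1 + pE need not be trivial, but s kills it, so s(T)^p = 1.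
  have hT : T ^ p ∈ Delta hn hG := by
    rw [mem_Delta_iff]
    intro j x
    rw [val_unitOfSqZero_pow]
    refine ⟨E (DirectSum.of G j x) j, ?_⟩
    have : diagBlock (1 + p • E : AddMonoid.End (⨁ i, G i)) j x =
      DirectSum.of G j x j + p • E (DirectSum.of G j x) j := rfl
    rw [this, DirectSum.of_eq_same, add_sub_cancel_left]
    rfl
  let C : AddMonoid.End (⨁ i, G i) := (s T : AddMonoid.End (⨁ i, G i)) - T
  have hC : ∀ k, ∀ x ∈ socleLayer p k (⨁ i, G i), C x ∈ socleLayer p (k + 1) (⨁ i, G i) :=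
    fun k x hx => apply_mem_socleLayer_succ hn hG C k
      (fun j _ x => (inv_mul_mem_Delta_iff hn hG).1 (hs T) j x) hx
  let N : AddMonoid.End (⨁ i, G i) := C + E
  have hN1 : N + 1 = (s T : AddMonoid.End (⨁ i, G i)) := by
    change (s T : AddMonoid.End (⨁ i, G i)) - (1 + E) + E + 1 = _
    abel
  have hEl : ∀ l, l + 1 ≠ n i → ∀ x ∈ socleLayer p l (⨁ i, G i),
      E x ∈ socleLayer p (l + 1) (⨁ i, G i) := fun l hl x hx =>
    apply_mem_socleLayer_succ hn hG E l (fun j hj x => by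
      have hji : j ≠ i := by rintro rfl; exact hl hj.symm
      have : diagBlock E j x = 0 := diagBlock_singleBlock_of_ne hji f x
      rw [this]
      exact zero_mem _) hx
  have hNl : ∀ l, l + 1 ≠ n i → ∀ x ∈ socleLayer p l (⨁ i, G i),
      N x ∈ socleLayer p (l + 1) (⨁ i, G i) := fun l hl x hx =>
    add_mem (hC l x hx) (hEl l hl x hx)
  -- At the level of G_i itself E does not shift the layer. Still N² does, as E² = 0 and every other
  -- product contains the shifting factor C.
  have hN2 : ∀ x ∈ socleLayer p (k + 1) (⨁ i, G i), N (N x) ∈ socleLayer p (k + 2) (⨁ i, G i) := by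
    intro x hx
    have h1 : N (N x) = N (C x) + (C (E x) + E (E x)) := by
      change N (C x + E x) = _
      rw [map_add]
      rfl
    have h2 : E (E x) = 0 := DFunLike.congr_fun hE x
    rw [h1, h2, add_zero]
    exact add_mem (map_mem_socleLayer N (hC _ x hx)) (hC _ _ (map_mem_socleLayer E hx))
  let y : G i := e.symm (Pi.single b 1)
  let u : ⨁ i, G i := DirectSum.of G i (p ^ (k + 1) • y)
  have hu : u ∈ socleLayer p (k + 1) (⨁ i, G i) := by
    refine mem_socleLayer.2 ⟨?_, DirectSum.of G i y, (map_nsmul _ _ _).symm⟩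
    rw [← map_nsmul, ← mul_smul, ← pow_succ', show k + 1 + 1 = n i from hk.symm, (hG i).pow_nsmul,
      map_zero]
  have hNu : N u ∈ socleLayer p (k + 2) (⨁ i, G i) :=
    apply_mem_socleLayer_of_pow_eq_one hp.out hp5 k N
      (by rw [hN1, ← Units.val_pow_eq_pow_val, ← map_pow, hs1 _ hT, Units.val_one])
      (hNl k (by omega)) hN2 (hNl (k + 2) (by omega)) hu
  have hEu : E u ∈ socleLayer p (k + 2) (⨁ i, G i) := by
    have h1 : E u = N u - C u := (add_sub_cancel_left (C u) (E u)).symm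
    rw [h1]
    exact sub_mem hNu (hC _ u hu)
  obtain ⟨-, z, hz⟩ := mem_socleLayer.1 hEu
  -- E u lies in G_i and is divisible by p^(k+2) = p^(n_i), hence is zero. Its coordinate at a is
  -- p^(k+1), which is nonzero in ℤ/p^(k+2).
  have h0 : f (p ^ (k + 1) • y) = 0 := by
    have h1 : E u = DirectSum.of G i (f (p ^ (k + 1) • y)) := by
      change DirectSum.of G i (f (DirectSum.of G i (p ^ (k + 1) • y) i)) = _
      rw [DirectSum.of_eq_same]
    have h2 : (p ^ (k + 2) • z) i = p ^ n i • z i := by rw [hk]; rfl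
    have h3 := DFunLike.congr_fun (hz.trans h1) i
    rw [h2, (hG i).pow_nsmul, DirectSum.of_eq_same] at h3
    exact h3.symm
  have h1 := congrFun (congrArg e h0) a
  rw [map_nsmul, map_nsmul, apply_endOfMatrix, e.apply_symm_apply, map_zero, Matrix.mulVec_single_one]
    at h1
  simp only [Pi.smul_apply, Matrix.col_apply, Matrix.single_apply_same, Pi.zero_apply, nsmul_eq_mul,
    mul_one] at h1
  rw [ZMod.natCast_eq_zero_iff, hk, Nat.pow_dvd_pow_iff_le_right hp.out.one_lt] at h1
  omega

end LargePrime

/-! ### Matrix obstructions modulo 9 and modulo 4. -/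

section SmallPrimes

open Matrix

theorem Matrix.add_smul_mul_add_smul {m R : Type*} [Fintype m] [CommRing R] {ε : R}
    (hε : ε * ε = 0) (S T X Y : Matrix m m R) :
    (S + ε • X) * (T + ε • Y) = S * T + ε • (S * Y + X * T) := by
  rw [add_mul, mul_add, mul_add, smul_mul_smul_comm, hε, zero_smul, add_zero, mul_smul_comm,
    smul_mul_assoc, smul_add, add_assoc]

theorem ZMod.exists_eq_mul_of_castHom_eq_zero {p k : ℕ} [NeZero p] (h : p ∣ p ^ k) {x : ZMod (p ^ k)}
    (hx : ZMod.castHom h (ZMod p) x = 0) : ∃ z, x = p * z := by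
  have : NeZero (p ^ k) := ⟨pow_ne_zero _ (NeZero.ne p)⟩
  rw [← ZMod.natCast_zmod_val x, map_natCast, ZMod.natCast_eq_zero_iff] at hx
  obtain ⟨c, hc⟩ := hx
  exact ⟨c, by rw [← ZMod.natCast_zmod_val x, hc, Nat.cast_mul]⟩

theorem Matrix.exists_eq_add_smul_of_map_eq {m : Type*} {p k : ℕ} [NeZero p] (h : p ∣ p ^ k)
    {A B : Matrix m m (ZMod (p ^ k))}
    (hAB : A.map (ZMod.castHom h (ZMod p)) = B.map (ZMod.castHom h (ZMod p))) :
    ∃ X, A = B + (p : ZMod (p ^ k)) • X := by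
  have key : ∀ i j, ∃ z, A i j - B i j = p * z := fun i j =>
    ZMod.exists_eq_mul_of_castHom_eq_zero h (by
      rw [map_sub, sub_eq_zero]
      exact congrFun₂ hAB i j)
  choose X hX using key
  exact ⟨Matrix.of X, Matrix.ext fun i j => by simp [← hX]⟩

/-- A partial lift of `GL_d(ℤ) → GL_d(ℤ/p)` through matrices over `ℤ/p²` that is trivial on the
principal congruence subgroup. -/
structure CongruenceLift (p d : ℕ) where
  toHom : GL (Fin d) ℤ →* Matrix (Fin d) (Fin d) (ZMod (p ^ 2))
  map_toHom : ∀ g : GL (Fin d) ℤ, (toHom g).map (ZMod.castHom (dvd_pow_self p two_ne_zero) (ZMod p)) =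
    (g : Matrix (Fin d) (Fin d) ℤ).map (Int.castRingHom (ZMod p))
  toHom_eq_one : ∀ g : GL (Fin d) ℤ,
    (g : Matrix (Fin d) (Fin d) ℤ).map (Int.castRingHom (ZMod p)) = 1 →
    toHom g = 1

theorem CongruenceLift.exists_eq {p d : ℕ} [NeZero p] (ψ : CongruenceLift p d)
    (g : GL (Fin d) ℤ) : ∃ X : Matrix (Fin d) (Fin d) (ZMod (p ^ 2)), ψ.toHom g = (g : Matrix (Fin d) (Fin d) ℤ).map (Int.castRingHom (ZMod (p ^ 2))) +
      (p : ZMod (p ^ 2)) • X := by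
  refine Matrix.exists_eq_add_smul_of_map_eq (dvd_pow_self p two_ne_zero) ?_
  rw [ψ.map_toHom, Matrix.map_map]
  refine Matrix.ext fun i j => ?_
  simp

theorem CongruenceLift.isEmpty_three_three : IsEmpty (CongruenceLift 3 3) := by
  refine ⟨fun ψ => ?_⟩
  let g : GL (Fin 3) ℤ := ⟨!![1, 1, 0; 0, 1, 0; 0, 0, 1], !![1, -1, 0; 0, 1, 0; 0, 0, 1],
    by decide +kernel, by decide +kernel⟩
  let g' : GL (Fin 3) ℤ := ⟨!![1, 0, 1; 0, 1, 0; 0, 0, 1], !![1, 0, -1; 0, 1, 0; 0, 0, 1],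
    by decide +kernel, by decide +kernel⟩
  have h1 : ψ.toHom (g * (g * g)) = 1 := ψ.toHom_eq_one (g * (g * g)) (by decide +kernel)
  have h2 : ψ.toHom (g * g') = ψ.toHom (g' * g) := congrArg _ (by decide +kernel)
  obtain ⟨X, hX⟩ := ψ.exists_eq g
  obtain ⟨Y, hY⟩ := ψ.exists_eq g'
  have h9 : ((3 : ℕ) : ZMod (3 ^ 2)) * (3 : ℕ) = 0 := by decide
  have hg : (g : Matrix (Fin 3) (Fin 3) ℤ).map (Int.castRingHom (ZMod (3 ^ 2))) =
    !![1, 1, 0; 0, 1, 0; 0, 0, 1] := by decide +kernel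
  have hg' : (g' : Matrix (Fin 3) (Fin 3) ℤ).map (Int.castRingHom (ZMod (3 ^ 2))) =
    !![1, 0, 1; 0, 1, 0; 0, 0, 1] := by decide +kernel
  rw [hg] at hX
  rw [hg'] at hY
  rw [map_mul, map_mul, hX, add_smul_mul_add_smul h9, add_smul_mul_add_smul h9] at h1
  rw [map_mul, map_mul, hX, hY, add_smul_mul_add_smul h9, add_smul_mul_add_smul h9] at h2
  -- With ψ(g) = g + 3X, the entry (0,1) of ψ(g)³ = 1 reads 3(1 + X₁₀) = 0 modulo 9. The entry (1,2)
  -- of the commutation with ψ(g') reads 3X₁₀ = 0.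
  have e1 := congrFun₂ h1 0 1
  have e2 := congrFun₂ h2 1 2
  simp [-Matrix.cons_mul, Matrix.mul_apply, Fin.sum_univ_three] at e1 e2
  have h9' : (9 : ZMod (3 ^ 2)) = 0 := by decide
  have : (3 : ZMod (3 ^ 2)) = 0 := by
    linear_combination e1 - (X 0 1 + X 1 1 + X 0 0) * h9' - e2
  exact absurd this (by decide)

theorem CongruenceLift.isEmpty_two_four : IsEmpty (CongruenceLift 2 4) := by
  refine ⟨fun ψ => ?_⟩
  let g : GL (Fin 4) ℤ := ⟨!![1, 0, 1, 0; 0, 1, 1, 1; 0, 0, 1, 0; 0, 0, 0, 1],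
    !![1, 0, -1, 0; 0, 1, -1, -1; 0, 0, 1, 0; 0, 0, 0, 1], by decide +kernel, by decide +kernel⟩
  let g' : GL (Fin 4) ℤ := ⟨!![1, 1, 0, 0; 0, 1, 0, 0; 0, 0, 1, 1; 0, 0, 0, 1],
    !![1, -1, 0, 0; 0, 1, 0, 0; 0, 0, 1, -1; 0, 0, 0, 1], by decide +kernel, by decide +kernel⟩
  have h1 : ψ.toHom (g * g) = 1 := ψ.toHom_eq_one (g * g) (by decide +kernel)
  have h2 : ψ.toHom (g' * g') = 1 := ψ.toHom_eq_one (g' * g') (by decide +kernel)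
  -- Modulo 2, g and g' are involutions and (g g')⁴ = 1, so the two squares agree there, and ψ does
  -- not distinguish matrices congruent modulo 2.
  have h3 : ψ.toHom ((g * g') * (g * g')) = ψ.toHom ((g' * g) * (g' * g)) := by
    rw [← inv_mul_cancel_right ((g * g') * (g * g')) ((g' * g) * (g' * g)), map_mul,
      ψ.toHom_eq_one ((g * g') * (g * g') * ((g' * g) * (g' * g))⁻¹) (by decide +kernel), one_mul]
  obtain ⟨X, hX⟩ := ψ.exists_eq g
  obtain ⟨Y, hY⟩ := ψ.exists_eq g'
  have h4 : ((2 : ℕ) : ZMod (2 ^ 2)) * (2 : ℕ) = 0 := by decide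
  have hg : (g : Matrix (Fin 4) (Fin 4) ℤ).map (Int.castRingHom (ZMod (2 ^ 2))) =
    !![1, 0, 1, 0; 0, 1, 1, 1; 0, 0, 1, 0; 0, 0, 0, 1] := by decide +kernel
  have hg' : (g' : Matrix (Fin 4) (Fin 4) ℤ).map (Int.castRingHom (ZMod (2 ^ 2))) =
    !![1, 1, 0, 0; 0, 1, 0, 0; 0, 0, 1, 1; 0, 0, 0, 1] := by decide +kernel
  rw [hg] at hX
  rw [hg'] at hY
  rw [map_mul, hX, add_smul_mul_add_smul h4] at h1
  rw [map_mul, hY, add_smul_mul_add_smul h4] at h2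
  rw [map_mul, map_mul, map_mul, map_mul, hX, hY, add_smul_mul_add_smul h4,
    add_smul_mul_add_smul h4, add_smul_mul_add_smul h4, add_smul_mul_add_smul h4] at h3
  -- These six entries are chosen so that in their sum the unknowns X and Y occur only with
  -- coefficients divisible by 4, leaving 2 = 0.
  have e1 := congrFun₂ h1 0 3
  have e2 := congrFun₂ h1 1 2
  have e3 := congrFun₂ h2 0 1
  have e4 := congrFun₂ h2 2 1
  have e5 := congrFun₂ h2 2 3
  have e6 := congrFun₂ h3 0 3
  simp [-Matrix.cons_mul, Matrix.mul_apply, Fin.sum_univ_four] at e1 e2 e3 e4 e5 e6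
  have h4' : (4 : ZMod (2 ^ 2)) = 0 := by decide
  have : (2 : ZMod (2 ^ 2)) = 0 := by
    linear_combination e1 + e2 + e3 + e4 + e5 + e6 - (1 + X 0 3 + X 0 0 - X 1 3 + X 0 1 + X 0 2
      - X 3 3 + X 1 2 + X 2 2 + X 3 2 + Y 2 1 + Y 2 0 + Y 2 2 + 2 * Y 2 3 + Y 3 3) * h4'
  exact absurd this (by decide)

end SmallPrimes

/-! ### Necessity for p = 2, 3: diagonal blocks modulo p². -/

section Gap

open Matrix

variable {ι : Type*} [LinearOrder ι] {p : ℕ} {n r : ι → ℕ}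
  {G : ι → Type*} [∀ i, AddCommGroup (G i)]

theorem endOfMatrix_symm_apply {A : Type*} [AddCommGroup A] {N r : ℕ}
    (e : A ≃+ (Fin r → ZMod N)) (f : AddMonoid.End A) (k l : Fin r) :
    (endOfMatrix e).symm f k l = e (f (e.symm (Pi.single l 1))) k := by
  obtain ⟨M, rfl⟩ := (endOfMatrix e).surjective f
  rw [RingEquiv.symm_apply_apply, apply_endOfMatrix, e.apply_symm_apply, mulVec_single_one]
  rfl

theorem map_endOfMatrix_symm_eq_zero {A : Type*} [AddCommGroup A] {N N' r : ℕ}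
    (e : A ≃+ (Fin r → ZMod N)) (h : N' ∣ N) (f : AddMonoid.End A)
    (hf : ∀ x, ∃ w, N' • w = f x) :
    ((endOfMatrix e).symm f).map (ZMod.castHom h (ZMod N')) = 0 := by
  refine Matrix.ext fun k l => ?_
  obtain ⟨w, hw⟩ := hf (e.symm (Pi.single l 1))
  rw [map_apply, endOfMatrix_symm_apply, ← hw, map_nsmul, Pi.smul_apply, map_nsmul, nsmul_eq_mul,
    CharP.cast_eq_zero, zero_mul, Matrix.zero_apply]

/-- The version modulo `p ^ 2` of `apply_mem_pMultiples`, in the absence of neighbouring levels. -/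
theorem exists_sq_nsmul_eq_apply [Fact p.Prime] (hG : ∀ i, IsHomocyclic p (n i) (r i) (G i))
    {i : ι} (hgap : ∀ j, j ≠ i → n j + 2 ≤ n i ∨ n i + 2 ≤ n j)
    (A : AddMonoid.End (⨁ i, G i)) (z : ⨁ i, G i) (hz : p ^ n i • z = 0) (hzi : z i = 0) :
    ∃ w, p ^ 2 • w = A z i := by
  classical
  suffices h : ∀ j, A (DirectSum.of G j (z j)) i ∈
      (nsmulAddMonoidHom (α := G i) (p ^ 2)).range by
    change A z i ∈ (nsmulAddMonoidHom (α := G i) (p ^ 2)).range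
    rw [← DirectSum.sum_support_of z, map_sum, DFinsupp.finsetSum_apply]
    exact sum_mem fun j _ => h j
  intro j
  by_cases hji : j = i
  · subst hji
    rw [hzi, map_zero, map_zero]
    exact zero_mem _
  -- From a lower level, the image is killed by p^(n_i - 2), hence divisible by p² in G_i. From a
  -- higher level, z_j is killed by p^(n_i), hence itself divisible by p².
  rcases hgap j hji with h | h
  · refine (hG i).exists_pow_nsmul_eq h ?_
    rw [← DFinsupp.smul_apply, ← map_nsmul, ← map_nsmul, (hG j).pow_nsmul, map_zero, map_zero]
    rfl
  · obtain ⟨w, hw⟩ := (hG j).exists_pow_nsmul_eq (a := 2) (m := n i) (x := z j) h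
      (DFunLike.congr_fun hz j)
    refine ⟨A (DirectSum.of G j w) i, ?_⟩
    rw [← hw, map_nsmul, map_nsmul]
    rfl

/-- The diagonal block as an element of the endomorphism ring. -/
def diagEnd (A : AddMonoid.End (⨁ i, G i)) (i : ι) : AddMonoid.End (G i) := diagBlock A i

/-- The diagonal block at an isolated level, as a matrix over `ℤ/p²`. -/
def blockModSq [Fact p.Prime] (hG : ∀ i, IsHomocyclic p (n i) (r i) (G i))
    {i : ι} (hgap : ∀ j, j ≠ i → n j + 2 ≤ n i ∨ n i + 2 ≤ n j) (hi : p ^ 2 ∣ p ^ n i)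
    (e : G i ≃+ (Fin (r i) → ZMod (p ^ n i))) :
    AddMonoid.End (⨁ i, G i) →* Matrix (Fin (r i)) (Fin (r i)) (ZMod (p ^ 2)) where
  toFun A := ((endOfMatrix e).symm (diagEnd A i)).map (ZMod.castHom hi (ZMod (p ^ 2)))
  map_one' := by
    have : diagEnd (1 : AddMonoid.End (⨁ i, G i)) i = 1 :=
      AddMonoidHom.ext fun x => DirectSum.of_eq_same _ _
    rw [this, map_one, Matrix.map_one _ (map_zero _) (map_one _)]
  map_mul' A B := by
    have h := map_endOfMatrix_symm_eq_zero e hi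
      (diagEnd (A * B) i - diagEnd A i * diagEnd B i)
      (fun x => by
        obtain ⟨w, hw⟩ := exists_sq_nsmul_eq_apply hG hgap A
          (B (DirectSum.of G i x) - DirectSum.of G i (B (DirectSum.of G i x) i)) (by
            rw [nsmul_sub, ← map_nsmul, ← map_nsmul, ← map_nsmul, (hG i).pow_nsmul,
              (hG i).pow_nsmul, map_zero, map_zero, sub_zero]) (by
            rw [DirectSum.sub_apply, DirectSum.of_eq_same, sub_self])
        refine ⟨w, hw.trans ?_⟩
        rw [map_sub, DirectSum.sub_apply]
        rfl)
    rw [map_sub, map_mul, Matrix.map_sub _ (map_sub _), Matrix.map_mul, sub_eq_zero] at h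
    exact h

theorem blockModSq_map_eq [Fact p.Prime] (hG : ∀ i, IsHomocyclic p (n i) (r i) (G i))
    {i : ι} (hgap : ∀ j, j ≠ i → n j + 2 ≤ n i ∨ n i + 2 ≤ n j) (hi : p ^ 2 ∣ p ^ n i)
    (hi' : p ∣ p ^ n i) (h2 : p ∣ p ^ 2)
    (e : G i ≃+ (Fin (r i) → ZMod (p ^ n i))) (A : AddMonoid.End (⨁ i, G i))
    (M : Matrix (Fin (r i)) (Fin (r i)) (ZMod (p ^ n i)))
    (h : ∀ x, diagBlock A i x - endOfMatrix e M x ∈ pMultiples p (G i)) :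
    (blockModSq hG hgap hi e A).map (ZMod.castHom h2 (ZMod p)) =
      M.map (ZMod.castHom hi' (ZMod p)) := by
  have h0 := map_endOfMatrix_symm_eq_zero e hi'
    (diagEnd A i - endOfMatrix e M) h
  rw [map_sub, RingEquiv.symm_apply_apply, Matrix.map_sub _ (map_sub _), sub_eq_zero] at h0
  rw [← h0]
  refine Matrix.ext fun k l => ?_
  exact DFunLike.congr_fun (RingHom.ext_zmod ((ZMod.castHom h2 (ZMod p)).comp
    (ZMod.castHom hi (ZMod (p ^ 2)))) (ZMod.castHom hi' (ZMod p))) _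

theorem ZMod.mul_eq_zero_of_castHom_eq_zero [NeZero p] (h : p ∣ p ^ 2) {x y : ZMod (p ^ 2)}
    (hx : ZMod.castHom h (ZMod p) x = 0) (hy : ZMod.castHom h (ZMod p) y = 0) : x * y = 0 := by
  obtain ⟨a, rfl⟩ := ZMod.exists_eq_mul_of_castHom_eq_zero h hx
  obtain ⟨b, rfl⟩ := ZMod.exists_eq_mul_of_castHom_eq_zero h hy
  have : ((p : ZMod (p ^ 2)) * p) = 0 := by
    rw [← Nat.cast_mul, ← sq, CharP.cast_eq_zero]
  linear_combination a * b * this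

/-- Compression of a representation over `ℤ/p²` that is block diagonal modulo `p`. -/
def compressBlock [NeZero p] {H α β : Type*} [Monoid H] [Fintype α] [Fintype β] [DecidableEq α]
    [DecidableEq β] (h : p ∣ p ^ 2) (θ : H →* Matrix (α ⊕ β) (α ⊕ β) (ZMod (p ^ 2)))
    (h₁₂ : ∀ g, (θ g).toBlocks₁₂.map (ZMod.castHom h (ZMod p)) = 0)
    (h₂₁ : ∀ g, (θ g).toBlocks₂₁.map (ZMod.castHom h (ZMod p)) = 0) :
    H →* Matrix α α (ZMod (p ^ 2)) where
  toFun g := (θ g).toBlocks₁₁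
  map_one' := by
    rw [map_one, ← fromBlocks_one, toBlocks_fromBlocks₁₁]
  map_mul' g g' := by
    rw [map_mul, ← fromBlocks_toBlocks (θ g), ← fromBlocks_toBlocks (θ g'), fromBlocks_multiply,
      toBlocks_fromBlocks₁₁, toBlocks_fromBlocks₁₁, toBlocks_fromBlocks₁₁, add_eq_left]
    -- The error term is a product of two off-diagonal blocks, both multiples of p, so it vanishes
    -- modulo p².
    refine Matrix.ext fun k l => Finset.sum_eq_zero fun j _ => ?_
    exact ZMod.mul_eq_zero_of_castHom_eq_zero h (congrFun₂ (h₁₂ g) k j) (congrFun₂ (h₂₁ g') j l)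

/-- Automorphisms of a summand act on the direct sum. -/
def summandAut {i : ι} {N s : ℕ} (e : G i ≃+ (Fin s → ZMod N)) :
    GL (Fin s) (ZMod N) →* (AddMonoid.End (⨁ i, G i))ˣ :=
  Units.map (((blockDiag G).comp (MonoidHom.mulSingle (fun i => AddMonoid.End (G i)) i)).comp
    (endOfMatrix e : Matrix (Fin s) (Fin s) (ZMod N) →* AddMonoid.End (G i)))

theorem diagBlock_summandAut {i : ι} {N s : ℕ} (e : G i ≃+ (Fin s → ZMod N))
    (g : GL (Fin s) (ZMod N)) (x : G i) :
    diagBlock (summandAut e g : AddMonoid.End (⨁ i, G i)) i x =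
      endOfMatrix e (g : Matrix (Fin s) (Fin s) (ZMod N)) x :=
  (diagBlock_blockDiag _ i x).trans (congrArg (fun f : AddMonoid.End (G i) => f x)
    (Pi.mulSingle_eq_same (M := fun i => AddMonoid.End (G i)) i (endOfMatrix e (g : Matrix (Fin s) (Fin s) (ZMod N)))))

theorem diagBlock_summandAut_of_ne {i j : ι} (hj : j ≠ i) {N s : ℕ} (e : G i ≃+ (Fin s → ZMod N))
    (g : GL (Fin s) (ZMod N)) (x : G j) :
    diagBlock (summandAut e g : AddMonoid.End (⨁ i, G i)) j x = x :=
  (diagBlock_blockDiag _ j x).trans (congrArg (fun f : AddMonoid.End (G j) => f x)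
    (Pi.mulSingle_eq_of_ne (M := fun i => AddMonoid.End (G i)) hj (endOfMatrix e (g : Matrix (Fin s) (Fin s) (ZMod N)))))

theorem summandAut_mem_Delta [Fact p.Prime] (hn : StrictMono n)
    (hG : ∀ i, IsHomocyclic p (n i) (r i) (G i)) {i : ι} (hi : p ∣ p ^ n i)
    (e : G i ≃+ (Fin (r i) → ZMod (p ^ n i))) {g : GL (Fin (r i)) (ZMod (p ^ n i))}
    (hg : (g : Matrix (Fin (r i)) (Fin (r i)) (ZMod (p ^ n i))).map (ZMod.castHom hi (ZMod p)) = 1) :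
    summandAut e g ∈ Delta hn hG := by
  rw [mem_Delta_iff]
  intro j x
  by_cases hj : j = i
  · subst hj
    obtain ⟨q, hq⟩ := IsHomocyclic.exists_quotient_equiv hi e
    have h := mk_endOfMatrix hi e q hq g x
    rw [hg, map_one] at h
    rw [diagBlock_summandAut, ← neg_add_eq_sub]
    exact QuotientAddGroup.eq.1 h.symm
  · rw [diagBlock_summandAut_of_ne hj, sub_self]
    exact zero_mem _

/-- Extension of a `d × d` integer matrix by an identity block, over `ℤ/N`. -/
def extendMatrix {d c s : ℕ} (σ : Fin s ≃ Fin d ⊕ Fin c) (R : Type*) [CommRing R] :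
    Matrix (Fin d) (Fin d) ℤ →* Matrix (Fin s) (Fin s) R where
  toFun M := (fromBlocks (M.map (Int.castRingHom R)) 0 0 1).submatrix σ σ
  map_one' := by
    rw [Matrix.map_one _ (map_zero _) (map_one _), fromBlocks_one, submatrix_one_equiv]
  map_mul' M M' := by
    rw [submatrix_mul_equiv, fromBlocks_multiply, Matrix.map_mul]
    simp

theorem extendMatrix_map {d c s : ℕ} (σ : Fin s ≃ Fin d ⊕ Fin c) {R S : Type*} [CommRing R]
    [CommRing S] (f : R →+* S) (M : Matrix (Fin d) (Fin d) ℤ) :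
    (extendMatrix σ R M).map f = extendMatrix σ S M := by
  change ((fromBlocks (M.map (Int.castRingHom R)) 0 0 1).submatrix σ σ).map f =
    (fromBlocks (M.map (Int.castRingHom S)) 0 0 1).submatrix σ σ
  rw [← submatrix_map, fromBlocks_map, Matrix.map_map, Matrix.map_zero _ (map_zero f),
    Matrix.map_zero _ (map_zero f), Matrix.map_one _ (map_zero f) (map_one f)]
  congr 2
  refine Matrix.ext fun k l => ?_
  simp

/-- An integer matrix acts on d coordinates of G_i. Applying s, reducing the i-th diagonal block
modulo p² and cutting out the d × d corner gives the lift. The corner is multiplicative because the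
block is block diagonal modulo p, and matrices congruent to 1 modulo p act by elements of Δ(G),
which s kills. -/
theorem IsSemidirectProductBy.nonempty_congruenceLift [hp : Fact p.Prime] (hn : StrictMono n)
    (hG : ∀ i, IsHomocyclic p (n i) (r i) (G i)) {Q : Type*} [Group Q]
    (h : IsSemidirectProductBy (Delta hn hG) Q) {i : ι} (hi : 2 ≤ n i)
    (hgap : ∀ j, j ≠ i → n j + 2 ≤ n i ∨ n i + 2 ≤ n j) {d : ℕ} (hd : d ≤ r i) :
    Nonempty (CongruenceLift p d) := by
  obtain ⟨s, hs, hs1⟩ := h.exists_retraction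
  obtain ⟨e⟩ := hG i
  have h2 : p ^ 2 ∣ p ^ n i := pow_dvd_pow p hi
  have h1 : p ∣ p ^ n i := dvd_pow_self p (by omega)
  have h12 : p ∣ p ^ 2 := dvd_pow_self p two_ne_zero
  have : NeZero p := ⟨hp.out.ne_zero⟩
  let σ : Fin (r i) ≃ Fin d ⊕ Fin (r i - d) :=
    (finCongr (Nat.add_sub_cancel' hd).symm).trans finSumFinEquiv.symm
  let ε : GL (Fin d) ℤ →* GL (Fin (r i)) (ZMod (p ^ n i)) :=
    Units.map (extendMatrix σ (ZMod (p ^ n i)))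
  let φ : GL (Fin d) ℤ →* Matrix (Fin (r i)) (Fin (r i)) (ZMod (p ^ 2)) :=
    (blockModSq hG hgap h2 e).comp ((Units.coeHom _).comp (s.comp ((summandAut e).comp ε)))
  have hφ : ∀ g, (φ g).map (ZMod.castHom h12 (ZMod p)) =
      extendMatrix σ (ZMod p) (g : Matrix (Fin d) (Fin d) ℤ) := fun g => by
    refine (blockModSq_map_eq hG hgap h2 h1 h12 e _ (ε g) fun x => ?_).trans
      (extendMatrix_map σ _ _)
    rw [← diagBlock_summandAut]
    exact (inv_mul_mem_Delta_iff hn hG).1 (hs (summandAut e (ε g))) i x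
  let θ : GL (Fin d) ℤ →* Matrix (Fin d ⊕ Fin (r i - d)) (Fin d ⊕ Fin (r i - d)) (ZMod (p ^ 2)) :=
    (reindexAlgEquiv ℤ (ZMod (p ^ 2)) σ : _ →* _).comp φ
  have hθ : ∀ g, (θ g).map (ZMod.castHom h12 (ZMod p)) = fromBlocks
      ((g : Matrix (Fin d) (Fin d) ℤ).map (Int.castRingHom (ZMod p))) 0 0 1 := fun g => by
    change ((φ g).map (ZMod.castHom h12 (ZMod p))).submatrix σ.symm σ.symm = _
    rw [hφ]
    change (fromBlocks ((g : Matrix (Fin d) (Fin d) ℤ).map _) 0 0 1).submatrix (σ ∘ σ.symm)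
      (σ ∘ σ.symm) = _
    rw [Equiv.self_comp_symm, submatrix_id_id]
  refine ⟨compressBlock h12 θ (fun g => congrArg toBlocks₁₂ (hθ g))
    (fun g => congrArg toBlocks₂₁ (hθ g)), fun g => congrArg toBlocks₁₁ (hθ g), fun g hg => ?_⟩
  have hg1 : summandAut e (ε g) ∈ Delta hn hG := by
    refine summandAut_mem_Delta hn hG h1 e ((extendMatrix_map σ _ _).trans ?_)
    change (fromBlocks ((g : Matrix (Fin d) (Fin d) ℤ).map _) 0 0 1).submatrix σ σ = 1
    rw [hg, fromBlocks_one, submatrix_one_equiv]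
  have hθ1 : θ g = 1 := by
    change (reindexAlgEquiv ℤ (ZMod (p ^ 2)) σ) (blockModSq hG hgap h2 e (s (summandAut e (ε g)) :
      AddMonoid.End (⨁ i, G i))) = 1
    rw [hs1 _ hg1, Units.val_one, map_one, map_one]
  change (θ g).toBlocks₁₁ = 1
  rw [hθ1, ← fromBlocks_one, toBlocks_fromBlocks₁₁]

end Gap

/-! ### From split reductions and rank bounds to the theorem. -/

section Main

variable {ι : Type*} [LinearOrder ι] {p : ℕ} {n r : ι → ℕ}
  {G : ι → Type*} [∀ i, AddCommGroup (G i)]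

theorem IsHomocyclic.isElementaryAbelian_iff [hp : Fact p.Prime] {n r : ℕ} {A : Type*}
    [AddCommGroup A] (h : IsHomocyclic p n r A) (hn : 1 ≤ n) (hr : 1 ≤ r) :
    IsElementaryAbelian p A ↔ n = 1 := by
  refine ⟨fun hA => ?_, ?_⟩
  · obtain ⟨e⟩ := h
    have h0 := congrFun (congrArg e (hA (e.symm fun _ => 1))) ⟨0, hr⟩
    rw [map_nsmul, e.apply_symm_apply, map_zero, Pi.smul_apply, Pi.zero_apply, nsmul_eq_mul,
      mul_one, ZMod.natCast_eq_zero_iff] at h0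
    have := (Nat.pow_dvd_pow_iff_le_right hp.out.one_lt).1 (h0.trans (pow_one p).symm.dvd)
    omega
  · rintro rfl x
    simpa using h.pow_nsmul x

theorem add_two_le_of_lt (hn : StrictMono n) (hgap : ∀ i j, i ⋖ j → 1 < (n j : ℤ) - n i) {i j : ι}
    (h : i < j) : n i + 2 ≤ n j := by
  -- The gap hypothesis concerns immediate successors only; strict monotonicity into ℕ provides one
  -- for every i that is not greatest.
  obtain ⟨k, hik, hk⟩ := WellFounded.has_min (InvImage.wf n Nat.lt_wfRel.wf) {k | i < k} ⟨j, h⟩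
  have hcov : i ⋖ k := ⟨hik, fun c hic hck => hk c hic (hn hck)⟩
  have h1 := hgap i k hcov
  have h2 : n k ≤ n j := not_lt.1 (hk j h)
  omega

/-- Splitting is decided by the ranks of the summands that are not elementary abelian. -/
theorem isSemidirectProductBy_iff_of_bound [Fact p.Prime] (hn_pos : ∀ i, 1 ≤ n i)
    (hr_pos : ∀ i, 1 ≤ r i) (hn : StrictMono n) (hG : ∀ i, IsHomocyclic p (n i) (r i) (G i))
    (R : ℕ) (hs : ∀ i (h : p ∣ p ^ n i), r i ≤ R → ReductionSplits p (n i) (r i) h)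
    (hR : IsSemidirectProductBy (Delta hn hG) ((i : ι) → GL (Fin (r i)) (ZMod p)) →
      ∀ i, 2 ≤ n i → r i ≤ R) :
    IsSemidirectProductBy (Delta hn hG) ((i : ι) → GL (Fin (r i)) (ZMod p)) ↔
      (∀ i, ¬ IsMin i → r i ≤ R) ∧ (∀ i, IsMin i → IsElementaryAbelian p (G i) ∨ r i ≤ R) := by
  refine ⟨fun h => ⟨fun i hi => hR h i ?_, fun i _ => ?_⟩, fun ⟨h₁, h₂⟩ =>
    isSemidirectProductBy_of_reductionSplits hn_pos hn hG fun i => ?_⟩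
  · obtain ⟨j, hj⟩ := not_isMin_iff.1 hi
    have h1 := hn hj
    have h2 := hn_pos j
    omega
  · rw [(hG i).isElementaryAbelian_iff (hn_pos i) (hr_pos i)]
    have h1 := hn_pos i
    by_cases h2 : n i = 1
    · exact .inl h2
    · exact .inr (hR h i (by omega))
  · have key : n i = 1 ∨ r i ≤ R := by
      by_cases hi : IsMin i
      · exact (h₂ i hi).imp_left ((hG i).isElementaryAbelian_iff (hn_pos i) (hr_pos i)).1
      · exact .inr (h₁ i hi)
    rcases key with h | h
    · have : ∀ m (hm : p ∣ p ^ m), m = 1 → ReductionSplits p m (r i) hm := by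
        rintro _ hm rfl
        exact reductionSplits_exponent_one hm
      exact this _ _ h
    · exact hs i _ h

end Main

theorem corollary2p9 {ι : Type*} [LinearOrder ι] (p : ℕ) [Fact p.Prime]
    (n r : ι → ℕ) (hn_pos : ∀ i, 1 ≤ n i) (hr_pos : ∀ i, 1 ≤ r i) (hn : StrictMono n)
    (G : ι → Type*) [∀ i, AddCommGroup (G i)]
    (hG : ∀ i, IsHomocyclic p (n i) (r i) (G i)) :
    (5 ≤ p →
      (IsSemidirectProductBy (Delta hn hG)
          ((i : ι) → Matrix.GeneralLinearGroup (Fin (r i)) (ZMod p)) ↔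
        (∀ i, ¬ IsMin i → r i = 1) ∧
        (∀ i, IsMin i → IsElementaryAbelian p (G i) ∨ r i = 1))) ∧
    (p = 3 → (∀ i j, i ⋖ j → 1 < (n j : ℤ) - n i) →
      (IsSemidirectProductBy (Delta hn hG)
          ((i : ι) → Matrix.GeneralLinearGroup (Fin (r i)) (ZMod p)) ↔
        (∀ i, ¬ IsMin i → r i ≤ 2) ∧
        (∀ i, IsMin i → IsElementaryAbelian p (G i) ∨ r i ≤ 2))) ∧
    (p = 2 → (∀ i j, i ⋖ j → 1 < (n j : ℤ) - n i) →
      (IsSemidirectProductBy (Delta hn hG)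
          ((i : ι) → Matrix.GeneralLinearGroup (Fin (r i)) (ZMod p)) ↔
        (∀ i, ¬ IsMin i → r i ≤ 3) ∧
        (∀ i, IsMin i → IsElementaryAbelian p (G i) ∨ r i ≤ 3))) := by
  have hone : ∀ i (h : p ∣ p ^ n i), r i = 1 → ReductionSplits p (n i) (r i) h := fun i h hi => by
    rw [hi]
    exact reductionSplits_one (hn_pos i) h
  have hlift : (∀ i j, i ⋖ j → 1 < (n j : ℤ) - n i) →
      IsSemidirectProductBy (Delta hn hG)
        ((i : ι) → Matrix.GeneralLinearGroup (Fin (r i)) (ZMod p)) →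
      ∀ i, 2 ≤ n i → ∀ d ≤ r i, Nonempty (CongruenceLift p d) := fun hgap h i hi d hd =>
    h.nonempty_congruenceLift hn hG hi (fun j hj => (lt_or_gt_of_ne hj).imp
      (add_two_le_of_lt hn hgap) (add_two_le_of_lt hn hgap)) hd
  refine ⟨fun hp5 => ?_, ?_, ?_⟩
  · have h1 : ∀ i, r i = 1 ↔ r i ≤ 1 := fun i => by have := hr_pos i; omega
    simp only [h1]
    exact isSemidirectProductBy_iff_of_bound hn_pos hr_pos hn hG 1
      (fun i h hi => hone i h ((h1 i).2 hi)) fun h i hi => h.rank_le_one hp5 hn hG i hi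
  · rintro rfl hgap
    refine isSemidirectProductBy_iff_of_bound hn_pos hr_pos hn hG 2 (fun i h hi => ?_)
      fun h i hi => ?_
    · obtain h1 | h2 : r i = 1 ∨ r i = 2 := by have := hr_pos i; omega
      · exact hone i h h1
      · rw [h2]
        exact reductionSplits_two_three _ _
    · by_contra! hr
      obtain ⟨ψ⟩ := hlift hgap h i hi 3 hr
      exact CongruenceLift.isEmpty_three_three.false ψ
  · rintro rfl hgap
    refine isSemidirectProductBy_iff_of_bound hn_pos hr_pos hn hG 3 (fun i h hi => ?_)
      fun h i hi => ?_
    · obtain h1 | h2 | h3 : r i = 1 ∨ r i = 2 ∨ r i = 3 := by have := hr_pos i; omega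
      · exact hone i h h1
      · rw [h2]
        exact reductionSplits_two_two _ _
      · rw [h3]
        exact reductionSplits_three_two _ _
    · by_contra! hr
      obtain ⟨ψ⟩ := hlift hgap h i hi 4 hr
      exact CongruenceLift.isEmpty_two_four.false ψ
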